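/- Let $d\ge 1$ and let $P_0,\dots,P_{d-1}\in\mathbb R^{d-1}$ be affinely independent. Put $f_i(X)=\frac12(X+P_i)$, $0\le i\le d-1$, and let $K$ be the Sierpiński simplex, the unique nonempty compact set with $K=\bigcup_i f_i(K)$. Let $V_0=\{P_0,\dots,P_{d-1}\}$ and $V_m=\bigcup_i f_i(V_{m-1})$ for $m\ge 1$. Write $X\sim_m Y$ if $X\ne Y$ are two points of $f_w(V_0)$ for a common word $w$ of length $m$ (where $f_w=f_{w_1}\circ\cdots\circ f_{w_m}$), and let $\Delta_m v(X)=\sum_{Y\sim_m X}(v(Y)-v(X))$. Let $\mu$ be the self-similar probability measure on $K$ with equal weights $1/d$, let $r=\frac{d}{d+2}$, and for $X\in V_m\setminus V_0$ let $\psi^{(m)}_X$ be the harmonic spline of order $m$: the continuous function on $K$ with $\psi^{(m)}_X(X)=1$, $\psi^{(m)}_X=0$ on $V_m\setminus\{X\}$, and $\Delta_n\psi^{(m)}_X=0$ on $V_n\setminus V_m$ for all $n>m$. For continuous $v,w:K\to\mathbb R$ write $\Delta v=w$ if $$\lim_{m\to\infty}r^{-m}\Big(\int_K\psi^{(m)}_{X_m}\,d\mu\Big)^{-1}\Delta_m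 v(X_m)=w(x)$$ for every $x\in K$ and every sequence $X_m\in V_m\setminus V_0$ ($m\ge 1$) with $X_m\to x$. Let $T>0$, let $g:K\to\mathbb R$, and let $u:[0,T]\times K\to\mathbb R$, continuous in $t\in[0,T]$ for each $x\in K$, be a solution of the heat equation: for every $t\in(0,T)$, $u(\cdot,x)$ is differentiable at $t$ for all $x\in K$ and $\partial_t u(t,\cdot)=\Delta u(t,\cdot)$ on $K$; $u(t,x)=0$ for $t\in[0,T)$ and $x\in V_0$; $u(0,\cdot)=g$ on $K$. For $m\ge 0$ and $N\ge 1$ let $h=T/N$ and let $u_h^m$ be the solution of the explicit Euler scheme $$\frac{u_h^m((k+1)h,X)-u_h^m(kh,X)}{h}=\frac d2(d+2)^m\Delta_m u_h^m(kh,X)\quad(0\le k\le N-1,\ X\in V_m\setminus V_0),$$ $$u_h^m(kh,P_j)=0,\qquad u_h^m(0,X)=g(X)\quad(X\in V_m\setminus V_0).$$ For $0\le k\le N-1$ and $X\in V_m\setminus V_0$ let $$\varepsilon^m_k(X)=\frac{u((k+1)h,X)-u(kh,X)}{h}-\frac d2(d+2)^m\Delta_m u(kh,X)$$ be the consistency error,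 and put $\varepsilon^m_k=0$ on $V_0$. For a family $(w^k)_k$ of functions on $V_m$ let $\|w\|_{2,\infty}=\max_k\big(d^{-m}\sum_{X\in V_m}|w^k(X)|^2\big)^{1/2}$, where $k$ runs over $0\le k\le N$ for the error $u(kh,\cdot)-u_h^m(kh,\cdot)$ and over $0\le k\le N-1$ for $\varepsilon^m$. All limits below are taken as $m\to\infty$ over the pairs $(m,N)$ that satisfy the CFL condition $h(d+2)^m\le \frac{2}{d^2}$ (so that $h\to0$ as well). Then: 1. If $\|\varepsilon^m\|_{2,\infty}\to 0$ (the scheme is consistent for $u$), then $\|u-u_h^m\|_{2,\infty}\to0$ (the scheme is convergent). 2. Let $\alpha>0$ and suppose that $\Delta u$ is $\alpha$-Hölder in space, uniformly in time, i.e. $|\Delta u(t,x)-\Delta u(t,y)|\le H|x-y|^\alpha$ for all $t\in(0,T)$ and $x,y\in K$, and that $\partial_t u$ is Lipschitz in time, uniformly in space, i.e. $|\partial_t u(s,x)-\partial_t u(t,x)|\le M|s-t|$ for all $s,t\in(0,T)$ and $x\in K$. Then there is a constant $C$, independent of $m$ and $N$, such that for all $m\ge 0$ and $N\ge1$ we have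 $|\varepsilon^m_k(X)|\le C\,(h+2^{-m\alpha})$ for all $0\le k\le N-1$ and $X\in V_m\setminus V_0$, and, if the CFL condition $h(d+2)^m\le\frac2{d^2}$ holds, then $$\|u-u_h^m\|_{2,\infty}\le C\,(h+2^{-m\alpha}).$$ In particular $\|u-u_h^m\|_{2,\infty}\to0$. -/

import Mathlib

open Set Filter Topology MeasureTheory

noncomputable section

namespace SierpinskiHeat

/-- The Euclidean space `ℝ^{d-1}` in which the simplex with `d` vertices lives. -/
abbrev Ambient (d : ℕ) : Type := EuclideanSpace ℝ (Fin (d - 1))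

variable {d : ℕ}

/-! ### The Sierpinski simplex and its graphs -/

/-- The contraction `X ↦ (X + P i) / 2` with fixed point `P i`. -/
def contraction (P : Fin d → Ambient d) (i : Fin d) (x : Ambient d) : Ambient d :=
  (2⁻¹ : ℝ) • (x + P i)

/-- `f_w = f_{w_1} ∘ ⋯ ∘ f_{w_m}` for a finite word `w`. -/
def wordMap (P : Fin d → Ambient d) : List (Fin d) → Ambient d → Ambient d
  | [] => id
  | i :: w => contraction P i ∘ wordMap P w

/-- The point with infinite address `ω`, the limit of `f_{ω 0} ∘ ⋯ ∘ f_{ω n}` as `n → ∞`. -/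
def address (P : Fin d → Ambient d) (ω : ℕ → Fin d) : Ambient d :=
  ∑' n, ((2⁻¹ : ℝ) ^ (n + 1)) • P (ω n)

/-- The Sierpinski simplex; `simplex_eq_iff` says that it is the unique nonempty compact set that
is the union of its images under the contractions. -/
def simplex (P : Fin d → Ambient d) : Set (Ambient d) := Set.range (address P)

theorem summable_address (P : Fin d → Ambient d) (ω : ℕ → Fin d) :
    Summable fun n => ((2⁻¹ : ℝ) ^ (n + 1)) • P (ω n) := by
  refine Summable.of_norm_bounded (g := fun n => (2⁻¹ : ℝ) ^ n * ∑ i, ‖P i‖)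
    ((summable_geometric_of_lt_one (by norm_num) (by norm_num)).mul_right _) fun n => ?_
  have h1 : ‖P (ω n)‖ ≤ ∑ i, ‖P i‖ :=
    Finset.single_le_sum (f := fun i => ‖P i‖) (fun i _ => norm_nonneg _) (Finset.mem_univ _)
  rw [norm_smul, Real.norm_of_nonneg (by positivity)]
  have h2 : (2⁻¹ : ℝ) ^ (n + 1) ≤ 2⁻¹ ^ n :=
    pow_le_pow_of_le_one (by norm_num) (by norm_num) (Nat.le_succ n)
  gcongr

theorem continuous_address (P : Fin d → Ambient d) : Continuous (address P) := by
  refine continuous_tsum (u := fun n => (2⁻¹ : ℝ) ^ n * ∑ i, ‖P i‖) (fun n => ?_)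
    ((summable_geometric_of_lt_one (by norm_num) (by norm_num)).mul_right _) fun n ω => ?_
  · have h1 : Continuous fun ω : ℕ → Fin d => ω n := continuous_apply n
    have h2 : Continuous P := continuous_of_discreteTopology
    exact (h2.comp h1).const_smul ((2⁻¹ : ℝ) ^ (n + 1))
  · have h1 : ‖P (ω n)‖ ≤ ∑ i, ‖P i‖ :=
      Finset.single_le_sum (f := fun i => ‖P i‖) (fun i _ => norm_nonneg _) (Finset.mem_univ _)
    rw [norm_smul, Real.norm_of_nonneg (by positivity)]
    have h2 : (2⁻¹ : ℝ) ^ (n + 1) ≤ 2⁻¹ ^ n :=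
      pow_le_pow_of_le_one (by norm_num) (by norm_num) (Nat.le_succ n)
    gcongr

theorem address_eq (P : Fin d → Ambient d) (ω : ℕ → Fin d) :
    address P ω = contraction P (ω 0) (address P fun n => ω (n + 1)) := by
  have h := (summable_address P ω).tsum_eq_zero_add
  have h' := (summable_address P fun n => ω (n + 1)).tsum_const_smul (2⁻¹ : ℝ)
  simp only [address, contraction]
  rw [h, smul_add, ← h', add_comm]
  simp [pow_succ', smul_smul]

theorem simplex_eq_iUnion (P : Fin d → Ambient d) :
    simplex P = ⋃ i, contraction P i '' simplex P := by
  ext x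
  simp only [simplex, Set.mem_range, Set.mem_iUnion, Set.mem_image, exists_exists_eq_and]
  constructor
  · rintro ⟨ω, rfl⟩
    exact ⟨ω 0, fun n => ω (n + 1), (address_eq P ω).symm⟩
  · rintro ⟨i, ω, rfl⟩
    let ω' : ℕ → Fin d := fun n => Nat.casesOn n i ω
    have h := address_eq P ω'
    exact ⟨ω', h⟩

/-- Two nonempty compact sets that are the unions of their images under the contractions are
contained in each other. -/
theorem subset_of_selfSimilar (P : Fin d → Ambient d) {K L : Set (Ambient d)}
    (hK : IsCompact K) (hKs : K = ⋃ i, contraction P i '' K)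
    (hL : IsCompact L) (hLne : L.Nonempty) (hLs : L = ⋃ i, contraction P i '' L) : K ⊆ L := by
  intro x hx
  obtain ⟨x₀, hx₀, hmax⟩ :=
    hK.exists_isMaxOn ⟨x, hx⟩ (Metric.continuous_infDist_pt L).continuousOn
  have h0 : x₀ ∈ ⋃ i, contraction P i '' K := hKs ▸ hx₀
  obtain ⟨i, y, hy, rfl⟩ := by simpa only [Set.mem_iUnion, Set.mem_image] using h0
  obtain ⟨z, hz, hyz⟩ := hL.exists_infDist_eq_dist hLne y
  have hz' : contraction P i z ∈ L := by
    rw [hLs]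
    exact Set.mem_iUnion.2 ⟨i, z, hz, rfl⟩
  have h1 : Metric.infDist (contraction P i y) L ≤ 2⁻¹ * Metric.infDist y L := by
    refine (Metric.infDist_le_dist_of_mem hz').trans ?_
    rw [hyz, contraction, contraction, dist_smul₀, dist_add_right]
    norm_num
  have h2 : Metric.infDist y L ≤ Metric.infDist (contraction P i y) L := hmax hy
  have h3 : Metric.infDist x L ≤ Metric.infDist (contraction P i y) L := hmax hx
  have h4 : Metric.infDist x L = 0 :=
    le_antisymm (by linarith) Metric.infDist_nonneg
  exact (hL.isClosed.mem_iff_infDist_zero hLne).2 h4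

theorem simplex_eq_iff [NeZero d] (P : Fin d → Ambient d) (K : Set (Ambient d)) :
    K = simplex P ↔ IsCompact K ∧ K.Nonempty ∧ K = ⋃ i, contraction P i '' K := by
  have hc : IsCompact (simplex P) := isCompact_range (continuous_address P)
  have hne : (simplex P).Nonempty := ⟨_, fun _ => 0, rfl⟩
  constructor
  · rintro rfl
    exact ⟨hc, hne, simplex_eq_iUnion P⟩
  · rintro ⟨h1, h2, h3⟩
    exact (subset_of_selfSimilar P h1 h3 hc hne (simplex_eq_iUnion P)).antisymm
      (subset_of_selfSimilar P hc (simplex_eq_iUnion P) h1 h2 h3)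

open Classical in
/-- The vertex set `V_m`: `V_0 = {P_0, …, P_{d-1}}` and `V_{m+1} = ⋃ i, f_i (V_m)`. -/
def vertices (P : Fin d → Ambient d) : ℕ → Finset (Ambient d)
  | 0 => Finset.univ.image P
  | m + 1 => Finset.univ.biUnion fun i => (vertices P m).image (contraction P i)

open Classical in
/-- The interior vertices `V_m \ V_0`. -/
def interiorVertices (P : Fin d → Ambient d) (m : ℕ) : Finset (Ambient d) :=
  vertices P m \ vertices P 0

/-- The relation `X ∼_m Y`: `X` and `Y` are distinct vertices of a common cell of order `m`. -/
def Adj (P : Fin d → Ambient d) (m : ℕ) (X Y : Ambient d) : Prop :=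
  X ≠ Y ∧ ∃ w : List (Fin d), w.length = m ∧
    ∃ i j : Fin d, X = wordMap P w (P i) ∧ Y = wordMap P w (P j)

open Classical in
/-- The graph Laplacian `Δ_m v (X) = ∑_{Y ∈ V_m, Y ∼_m X} (v Y - v X)`. -/
def graphLaplacian (P : Fin d → Ambient d) (m : ℕ) (v : Ambient d → ℝ) (X : Ambient d) : ℝ :=
  ∑ Y ∈ (vertices P m).filter (Adj P m X), (v Y - v X)

/-! ### The Laplacian on the simplex -/

/-- The standard self-similar probability measure `μ = (1/d) ∑ i, μ ∘ f_i⁻¹`: the law of the point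
whose address consists of independent uniform letters. -/
def selfSimilarMeasure [NeZero d] (P : Fin d → Ambient d) : Measure (Ambient d) :=
  (Measure.infinitePi fun _ : ℕ => (PMF.uniformOfFintype (Fin d)).toMeasure).map (address P)

/-- `ψ` is the harmonic spline `ψ_X^{(m)}`: it is continuous on the simplex, equals `1` at `X` and
`0` at the other points of `V_m`, and is graph harmonic at all later vertices. These conditions
determine it on the simplex. -/
structure IsHarmonicSpline (P : Fin d → Ambient d) (m : ℕ) (X : Ambient d)
    (ψ : Ambient d → ℝ) : Prop where
  continuousOn : ContinuousOn ψ (simplex P)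
  eq_one : ψ X = 1
  eq_zero : ∀ Y ∈ vertices P m, Y ≠ X → ψ Y = 0
  harmonic : ∀ n, m < n → ∀ Y ∈ vertices P n, Y ∉ vertices P m → graphLaplacian P n ψ Y = 0

/-- The renormalization ratio `r = d / (d + 2)` of the energy on the simplex. -/
def energyRatio (d : ℕ) : ℝ := (d : ℝ) / (d + 2)

/-- `v` is in the domain of the Laplacian and `Δ v = f`: both are continuous on the simplex and
`r^{-m} (∫ ψ_{X_m}^{(m)} dμ)⁻¹ Δ_m v (X_m) → f x` whenever `X_m ∈ V_m \ V_0` tends to `x`.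
There are no interior vertices of order `0`, so the sequences start at `m = 1`. -/
structure HasLaplacian [NeZero d] (P : Fin d → Ambient d) (v f : Ambient d → ℝ) : Prop where
  continuousOn : ContinuousOn v (simplex P)
  continuousOn_laplacian : ContinuousOn f (simplex P)
  tendsto : ∀ x ∈ simplex P, ∀ X : ℕ → Ambient d,
    (∀ m, 1 ≤ m → X m ∈ interiorVertices P m) → Tendsto X atTop (𝓝 x) →
    ∃ ψ : ℕ → Ambient d → ℝ, (∀ m, 1 ≤ m → IsHarmonicSpline P m (X m) (ψ m)) ∧
      Tendsto (fun m => (energyRatio d ^ m)⁻¹ * (∫ y, ψ m y ∂(selfSimilarMeasure P))⁻¹ *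
        graphLaplacian P m v (X m)) atTop (𝓝 (f x))

/-! ### The heat equation and the explicit scheme -/

/-- `u` solves the heat equation on `]0,T[ × simplex`, with `∂u/∂t = Δu = f` there, vanishes on the
boundary `V_0`, and starts from `g`. -/
structure IsHeatSolution [NeZero d] (P : Fin d → Ambient d) (T : ℝ) (g : Ambient d → ℝ)
    (u f : ℝ → Ambient d → ℝ) : Prop where
  continuousOn_time : ∀ x ∈ simplex P, ContinuousOn (fun t => u t x) (Icc 0 T)
  time_deriv : ∀ t ∈ Ioo 0 T, ∀ x ∈ simplex P, HasDerivAt (fun s => u s x) (f t x) t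
  laplacian : ∀ t ∈ Ioo 0 T, HasLaplacian P (u t) (f t)
  boundary : ∀ t ∈ Ico 0 T, ∀ x ∈ vertices P 0, u t x = 0
  initial : ∀ x ∈ simplex P, u 0 x = g x

/-- The normalized graph Laplacian `(d/2) (d+2)^m Δ_m`. -/
def normalizedLaplacian (P : Fin d → Ambient d) (m : ℕ) (v : Ambient d → ℝ) (X : Ambient d) : ℝ :=
  (d : ℝ) / 2 * ((d : ℝ) + 2) ^ m * graphLaplacian P m v X

open Classical in
/-- The explicit Euler scheme: `eulerScheme P m h g k X` is `u_h^m (k h, X)` for `X ∈ V_m`. -/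
def eulerScheme (P : Fin d → Ambient d) (m : ℕ) (h : ℝ) (g : Ambient d → ℝ) :
    ℕ → Ambient d → ℝ
  | 0 => fun X => if X ∈ vertices P 0 then 0 else g X
  | k + 1 => fun X => if X ∈ vertices P 0 then 0 else
      eulerScheme P m h g k X + h * normalizedLaplacian P m (eulerScheme P m h g k) X

/-- The error `u (k h, X) - u_h^m (k h, X)`. -/
def schemeError (P : Fin d → Ambient d) (m : ℕ) (h : ℝ) (g : Ambient d → ℝ)
    (u : ℝ → Ambient d → ℝ) (k : ℕ) (X : Ambient d) : ℝ :=
  u (k * h) X - eulerScheme P m h g k X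

open Classical in
/-- The consistency error at the interior vertices (and `0` at the boundary vertices): the residual
of the solution `u` in the explicit scheme. -/
def consistencyError (P : Fin d → Ambient d) (m : ℕ) (h : ℝ)
    (u : ℝ → Ambient d → ℝ) (k : ℕ) (X : Ambient d) : ℝ :=
  if X ∈ vertices P 0 then 0 else
    (u ((k + 1 : ℕ) * h) X - u (k * h) X) / h - normalizedLaplacian P m (u (k * h)) X

/-- `max_{0 ≤ k < K} (d^{-m} ∑_{X ∈ V_m} |w k X|²)^{1/2}`. -/
def normTwoInfty (P : Fin d → Ambient d) (m K : ℕ) (w : ℕ → Ambient d → ℝ) : ℝ :=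
  ⨆ k : Fin K, Real.sqrt (((d : ℝ) ^ m)⁻¹ * ∑ X ∈ vertices P m, |w k X| ^ 2)

/-- The Courant-Friedrichs-Lewy condition `h (d+2)^m ≤ 2 / d²`. -/
def CFL (d m : ℕ) (h : ℝ) : Prop := h * ((d : ℝ) + 2) ^ m ≤ 2 / (d : ℝ) ^ 2

/-- The limit `m → ∞` over the pairs `(m, N)`, `N ≥ 1`, for which `h = T / N` satisfies the CFL
condition (so that `h → 0` as well). -/
def cflLimit (d : ℕ) (T : ℝ) : Filter (ℕ × ℕ) :=
  comap Prod.fst atTop ⊓ 𝓟 {q | 1 ≤ q.2 ∧ CFL d q.1 (T / q.2)}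

end SierpinskiHeat

end

open SierpinskiHeat

noncomputable section

namespace SierpinskiHeat

variable {d : ℕ}

/-! Write `L_m = (d/2)(d+2)^m Δ_m`. The theorem is "consistency plus stability gives convergence" on
graphs whose cells are complete graphs on `d` vertices. The combinatorial input is that an interior
vertex lies in exactly two cells of each order (`card_fiber`), read off from integer barycentric
coordinates.

Normalization: harmonicity at the new midpoints of a cell preserves the mean over its corners, so
every spline of order `m` has integral `2 / d^(m+1)`. The limit defining `Δ` is therefore the limit
of the `L_m` (`normalizedLaplacian_eq`).

Consistency: `L_m v(X)` is a convex combination of values of `L_(m+1) v` in the two cells at `X`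
(`normalizedLaplacian_average`). For Hölder `Δv`, passing from order `m` to `m + 1` costs
`O(2^(-mα))`. These costs sum geometrically, and at high order compactness makes `L_n v` uniformly
close to `Δv`. The time increment is handled by the mean value theorem.

Stability: the Laplacian `A` of the complete graph satisfies `A² = -dA`. Summing over cells gives `∑
(Δ_m v)² ≤ -2d ∑ v Δ_m v`, so under the CFL condition an Euler step with zero boundary values does
not increase the `ℓ²` norm (`sum_sq_euler_le`). The error solves the scheme with source the
consistency error, hence is at most `T` times its norm; both assertions follow. -/

/-! ### Words, corners and integer barycentric coordinates -/

/-- The words of length `m`. -/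
def words (d m : ℕ) : Finset (List (Fin d)) :=
  (Finset.univ : Finset (Fin m → Fin d)).image List.ofFn

theorem mem_words {m : ℕ} {w : List (Fin d)} : w ∈ words d m ↔ w.length = m := by
  simp only [words, Finset.mem_image, Finset.mem_univ, true_and]
  constructor
  · rintro ⟨f, rfl⟩
    simp
  · rintro rfl
    exact ⟨w.get, List.ofFn_get w⟩

theorem card_words (d m : ℕ) : (words d m).card = d ^ m := by
  rw [words, Finset.card_image_of_injective _ List.ofFn_injective]
  simp

theorem sum_words_succ (m : ℕ) (F : List (Fin d) → ℝ) :
    ∑ w ∈ words d (m + 1), F w = ∑ w ∈ words d m, ∑ a, F (w ++ [a]) := by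
  rw [← Finset.sum_product']
  symm
  refine Finset.sum_bij (fun p _ => p.1 ++ [p.2]) ?_ ?_ ?_ ?_
  · intro p hp
    have := mem_words.1 (Finset.mem_product.1 hp).1
    simp [mem_words, this]
  · intro p _ q _ h
    have := List.append_inj' h rfl
    exact Prod.ext this.1 (by simpa using this.2)
  · intro w hw
    have hl := mem_words.1 hw
    have hne : w ≠ [] := by
      rintro rfl
      simp at hl
    exact ⟨(w.dropLast, w.getLast hne), by simp [mem_words, hl], List.dropLast_append_getLast hne⟩
  · intro p _
    rfl

/-- The corners `(w, i)` of the cells of order `m`. -/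
def corners (d m : ℕ) : Finset (List (Fin d) × Fin d) := words d m ×ˢ Finset.univ

/-- The vertex `f_w (P i)` at the corner `(w, i)`. -/
def cornerPoint (P : Fin d → Ambient d) (c : List (Fin d) × Fin d) : Ambient d :=
  wordMap P c.1 (P c.2)

theorem mem_corners {m : ℕ} {c : List (Fin d) × Fin d} : c ∈ corners d m ↔ c.1.length = m := by
  simp [corners, mem_words]

theorem mem_vertices (P : Fin d → Ambient d) {m : ℕ} {X : Ambient d} :
    X ∈ vertices P m ↔ ∃ c ∈ corners d m, cornerPoint P c = X := by
  induction m generalizing X with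
  | zero =>
    simp only [vertices, Finset.mem_image, Finset.mem_univ, true_and, mem_corners]
    constructor
    · rintro ⟨i, rfl⟩
      exact ⟨([], i), rfl, rfl⟩
    · rintro ⟨⟨w, i⟩, h, rfl⟩
      obtain rfl := List.length_eq_zero_iff.1 h
      exact ⟨i, rfl⟩
  | succ m ih =>
    simp only [vertices, Finset.mem_biUnion, Finset.mem_image, Finset.mem_univ, true_and, ih]
    constructor
    · rintro ⟨a, _, ⟨⟨w, i⟩, h, rfl⟩, rfl⟩
      exact ⟨(a :: w, i), by simpa [mem_corners] using h, rfl⟩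
    · rintro ⟨⟨w, i⟩, h, rfl⟩
      rw [mem_corners] at h
      cases w with
      | nil => simp at h
      | cons a w => exact ⟨a, _, ⟨(w, i), by simpa [mem_corners] using h, rfl⟩, rfl⟩

theorem cornerPoint_mem_vertices (P : Fin d → Ambient d) {m : ℕ} {c : List (Fin d) × Fin d}
    (hc : c.1.length = m) : cornerPoint P c ∈ vertices P m :=
  (mem_vertices P).2 ⟨c, mem_corners.2 hc, rfl⟩

theorem wordMap_append (P : Fin d → Ambient d) (u w : List (Fin d)) (x : Ambient d) :
    wordMap P (u ++ w) x = wordMap P u (wordMap P w x) := by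
  induction u with
  | nil => rfl
  | cons a u ih => simp [wordMap, ih]

theorem contraction_self (P : Fin d → Ambient d) (i : Fin d) : contraction P i (P i) = P i := by
  rw [contraction, ← two_smul ℝ (P i), smul_smul]
  norm_num

theorem contraction_comm (P : Fin d → Ambient d) (i j : Fin d) :
    contraction P i (P j) = contraction P j (P i) := by
  rw [contraction, contraction, add_comm]

theorem wordMap_replicate (P : Fin d → Ambient d) (i : Fin d) (k : ℕ) :
    wordMap P (List.replicate k i) (P i) = P i := by
  induction k with
  | zero => rfl
  | succ k ih => simp [List.replicate_succ, wordMap, ih, contraction_self]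

theorem dist_wordMap (P : Fin d → Ambient d) (w : List (Fin d)) (x y : Ambient d) :
    dist (wordMap P w x) (wordMap P w y) = (2⁻¹ : ℝ) ^ w.length * dist x y := by
  induction w with
  | nil => simp [wordMap]
  | cons a w ih =>
    simp only [wordMap, Function.comp_apply, contraction, List.length_cons]
    rw [dist_smul₀, dist_add_right, ih, Real.norm_of_nonneg (by norm_num), pow_succ']
    ring

theorem wordMap_injective (P : Fin d → Ambient d) (w : List (Fin d)) :
    Function.Injective (wordMap P w) := fun x y h => by
  have h1 := dist_wordMap P w x y
  rw [h, dist_self] at h1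
  have h2 : (2⁻¹ : ℝ) ^ w.length ≠ 0 := by positivity
  exact dist_eq_zero.1 ((mul_eq_zero.1 h1.symm).resolve_left h2)

/-- The integer barycentric coordinates of `2 ^ |w| • f_w 0`. -/
def weight : List (Fin d) → Fin d → ℕ
  | [] => 0
  | a :: w => Pi.single a (2 ^ w.length) + weight w

theorem sum_weight (w : List (Fin d)) : ∑ j, weight w j + 1 = 2 ^ w.length := by
  induction w with
  | nil => simp [weight]
  | cons a w ih =>
    simp only [weight, Pi.add_apply, Finset.sum_add_distrib, List.length_cons, pow_succ]
    rw [Finset.sum_pi_single']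
    simp
    omega

theorem weight_concat (w : List (Fin d)) (a : Fin d) :
    weight (w ++ [a]) = 2 • weight w + Pi.single a 1 := by
  induction w with
  | nil => simp [weight]
  | cons b w ih =>
    simp only [List.cons_append, weight, ih, List.length_append, List.length_singleton, pow_succ]
    ext j
    by_cases h : j = b
    · subst h
      simp
      ring
    · simp [Pi.single_eq_of_ne h]

theorem wordMap_eq (P : Fin d → Ambient d) (w : List (Fin d)) (x : Ambient d) :
    wordMap P w x = (2⁻¹ : ℝ) ^ w.length • (∑ j, (weight w j : ℝ) • P j + x) := by
  induction w with
  | nil => simp [wordMap, weight]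
  | cons a w ih =>
    have h : ∑ j, ((Pi.single a (2 ^ w.length) : Fin d → ℕ) j : ℝ) • P j
        = (2 ^ w.length : ℝ) • P a := by
      rw [Finset.sum_eq_single a]
      · simp
      · intro b _ hb
        simp [Pi.single_eq_of_ne hb]
      · simp
    simp only [wordMap, Function.comp_apply, ih, contraction, weight, Pi.add_apply, Nat.cast_add,
      add_smul, Finset.sum_add_distrib, h, List.length_cons, pow_succ']
    simp only [smul_add, smul_smul]
    have h2 : (2⁻¹ * 2⁻¹ ^ w.length * 2 ^ w.length : ℝ) = 2⁻¹ := by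
      rw [mul_assoc, ← mul_pow]
      norm_num
    rw [h2]
    abel

/-- Both sides carry barycentric coordinates with total `2 ^ |w|`, and affine independence makes
these unique. From here on coincidence of vertices is a question about integer vectors. -/
theorem weight_eq_of_cornerPoint_eq {P : Fin d → Ambient d} (hP : AffineIndependent ℝ P)
    {w w' : List (Fin d)} {i i' : Fin d} (hl : w.length = w'.length)
    (h : wordMap P w (P i) = wordMap P w' (P i')) :
    weight w + Pi.single i 1 = weight w' + Pi.single i' 1 := by
  have hs : ∀ (w : List (Fin d)) (i : Fin d), ∑ j, (weight w j : ℝ) • P j + P i =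
      ∑ j, ((weight w + Pi.single i 1 : Fin d → ℕ) j : ℝ) • P j := by
    intro w i
    simp only [Pi.add_apply, Nat.cast_add, add_smul, Finset.sum_add_distrib]
    congr 1
    rw [Finset.sum_eq_single i]
    · simp
    · intro b _ hb
      simp [Pi.single_eq_of_ne hb]
    · simp
  have ht : ∀ (w : List (Fin d)) (i : Fin d),
      ∑ j, ((weight w + Pi.single i 1 : Fin d → ℕ) j : ℝ) = 2 ^ w.length := by
    intro w i
    have h := sum_weight w
    have h2 : ∑ j, (weight w + Pi.single i 1 : Fin d → ℕ) j = 2 ^ w.length := by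
      simp only [Pi.add_apply, Finset.sum_add_distrib, Finset.sum_pi_single', Finset.mem_univ,
        if_true]
      exact h
    exact_mod_cast h2
  rw [wordMap_eq, wordMap_eq, hl, hs, hs] at h
  have h' := smul_right_injective _ (pow_ne_zero w'.length (by norm_num : (2⁻¹ : ℝ) ≠ 0)) h
  have key := (affineIndependent_iff.1 hP) Finset.univ
    (fun j => ((weight w + Pi.single i 1 : Fin d → ℕ) j : ℝ) -
      ((weight w' + Pi.single i' 1 : Fin d → ℕ) j : ℝ))
    (by rw [Finset.sum_sub_distrib, ht, ht, hl, sub_self])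
    (by simp only [sub_smul, Finset.sum_sub_distrib]; rw [sub_eq_zero]; exact h')
  funext j
  have := key j (Finset.mem_univ j)
  exact_mod_cast sub_eq_zero.1 this

/-- The coordinates add up to `2 ^ |w|`, so one coordinate of this size means that the vertex is `P
j`, and each order has only one corner there. -/
theorem eq_replicate_of_le_weight {w : List (Fin d)} {i j : Fin d}
    (h : 2 ^ w.length ≤ (weight w + Pi.single i 1 : Fin d → ℕ) j) :
    w = List.replicate w.length j ∧ i = j := by
  induction w with
  | nil =>
    refine ⟨rfl, ?_⟩
    by_contra hij
    simp [weight, Pi.single_eq_of_ne (Ne.symm hij)] at h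
  | cons a w ih =>
    simp only [weight, Pi.add_apply, List.length_cons, pow_succ] at h ih
    by_cases haj : j = a
    · subst haj
      simp only [Pi.single_eq_same] at h
      obtain ⟨h1, h2⟩ := ih (by omega)
      refine ⟨?_, h2⟩
      rw [List.length_cons, List.replicate_succ, ← h1]
    · exfalso
      simp only [Pi.single_eq_of_ne haj] at h
      have h1 := sum_weight w
      have h2 := Finset.single_le_sum (f := weight w) (fun _ _ => Nat.zero_le _)
        (Finset.mem_univ j)
      have h3 : (Pi.single i 1 : Fin d → ℕ) j ≤ 1 := by
        by_cases hij : j = i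
        · subst hij
          simp
        · simp [Pi.single_eq_of_ne hij]
      have h4 := Nat.one_le_two_pow (n := w.length)
      by_cases h5 : 2 ^ w.length = 1
      · have : weight w j = 0 := by omega
        omega
      · omega

/-- The letter `a'` contributes `2 ^ |w'|` to coordinate `a'` on the right; on the left only `w` and
`i` can supply it. Together with `eq_replicate_of_le_weight` this forces `w` to be constant. -/
theorem two_pow_le_of_weight_cons_eq {w w' : List (Fin d)} {a a' i i' : Fin d}
    (hl : w.length = w'.length) (ha : a ≠ a')
    (h : weight (a :: w) + Pi.single i 1 = weight (a' :: w') + Pi.single i' 1) :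
    2 ^ w.length ≤ (weight w + Pi.single i 1 : Fin d → ℕ) a' := by
  have := congrFun h a'
  simp only [weight, Pi.add_apply, Pi.single_eq_same, Pi.single_eq_of_ne ha.symm] at this
  simp only [Pi.add_apply]
  rw [hl]
  omega

/-- Two corners with the same vertex coincide or are of the form `(u a b ⋯ b, b)`,
`(u b a ⋯ a, a)`. -/
theorem eq_or_partner_of_weight_eq {w w' : List (Fin d)} {i i' : Fin d}
    (hl : w.length = w'.length)
    (h : weight w + Pi.single i 1 = weight w' + Pi.single i' 1) :
    (w = w' ∧ i = i') ∨ ∃ u k, w = u ++ i' :: List.replicate k i ∧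
      w' = u ++ i :: List.replicate k i' ∧ i' ≠ i := by
  induction w generalizing w' with
  | nil =>
    obtain rfl := List.length_eq_zero_iff.1 hl.symm
    refine Or.inl ⟨rfl, ?_⟩
    by_contra hi
    have := congrFun h i
    simp [weight, Pi.single_eq_of_ne hi] at this
  | cons a w ih =>
    cases w' with
    | nil => simp at hl
    | cons a' w' =>
      have hl' : w.length = w'.length := by simpa using hl
      by_cases ha : a = a'
      · subst ha
        rw [weight, weight, hl', add_assoc, add_assoc, add_right_inj] at h
        rcases ih hl' h with ⟨rfl, rfl⟩ | ⟨u, k, rfl, rfl, hne⟩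
        · exact Or.inl ⟨rfl, rfl⟩
        · exact Or.inr ⟨a :: u, k, rfl, rfl, hne⟩
      -- Two different first-level cells meet only in the midpoint of their fixed points, which
      -- forces both tails to be constant.
      · obtain ⟨h1, rfl⟩ := eq_replicate_of_le_weight (two_pow_le_of_weight_cons_eq hl' ha h)
        obtain ⟨h2, rfl⟩ := eq_replicate_of_le_weight
          (two_pow_le_of_weight_cons_eq hl'.symm (Ne.symm ha) h.symm)
        refine Or.inr ⟨[], w.length, ?_, ?_, ha⟩
        · rw [List.nil_append, ← h1]
        · rw [List.nil_append, hl', ← h2]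

/-- A cell is determined by any two of its vertices. -/
theorem eq_of_weight_eq_of_weight_eq {w w' : List (Fin d)} {i i' j j' : Fin d}
    (hl : w.length = w'.length) (hij : i ≠ j)
    (h : weight w + Pi.single i 1 = weight w' + Pi.single i' 1)
    (h' : weight w + Pi.single j 1 = weight w' + Pi.single j' 1) : w = w' := by
  induction w generalizing w' with
  | nil => exact (List.length_eq_zero_iff.1 hl.symm).symm
  | cons a w ih =>
    cases w' with
    | nil => simp at hl
    | cons a' w' =>
      have hl' : w.length = w'.length := by simpa using hl
      by_cases ha : a = a'
      · subst ha
        rw [weight, weight, hl', add_assoc, add_assoc, add_right_inj] at h h'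
        rw [ih hl' h h']
      -- With different first letters, both corners `i` and `j` would have to be `a'`.
      · have h1 := (eq_replicate_of_le_weight (two_pow_le_of_weight_cons_eq hl' ha h)).2
        have h2 := (eq_replicate_of_le_weight (two_pow_le_of_weight_cons_eq hl' ha h')).2
        exact absurd (h1.trans h2.symm) hij

/-- The decomposition is read off from the position of the last letter different from `b`. -/
theorem append_cons_replicate_inj {u u' : List (Fin d)} {a a' b : Fin d} {k k' : ℕ}
    (ha : a ≠ b) (ha' : a' ≠ b)
    (h : u ++ a :: List.replicate k b = u' ++ a' :: List.replicate k' b) :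
    u = u' ∧ a = a' ∧ k = k' := by
  have hs : ∀ (u : List (Fin d)) (a : Fin d) (k : ℕ),
      u ++ a :: List.replicate (k + 1) b = (u ++ a :: List.replicate k b) ++ [b] := by
    intro u a k
    rw [List.replicate_succ']
    simp
  induction k generalizing k' with
  | zero =>
    cases k' with
    | zero =>
      have := List.append_inj' h rfl
      exact ⟨this.1, by simpa using this.2, rfl⟩
    | succ k' =>
      rw [hs] at h
      have := (List.append_inj' h rfl).2
      exact absurd (by simpa using this) ha
  | succ k ih =>
    cases k' with
    | zero =>
      rw [hs] at h
      have := (List.append_inj' h rfl).2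
      exact absurd (by simpa using this.symm) ha'
    | succ k' =>
      rw [hs, hs] at h
      obtain ⟨h1, h2, h3⟩ := ih (List.append_inj' h rfl).1
      exact ⟨h1, h2, by rw [h3]⟩

/-- In the first case the corner `(w, b)` is the boundary vertex `P b`; in the second it is the
midpoint of the edge of cell `u` between corners `a` and `b`. -/
theorem eq_replicate_or_exists_append (w : List (Fin d)) (b : Fin d) :
    w = List.replicate w.length b ∨ ∃ u a k, a ≠ b ∧ w = u ++ a :: List.replicate k b := by
  induction w using List.reverseRecOn with
  | nil => exact Or.inl rfl
  | append_singleton w a ih =>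
    by_cases hab : a = b
    · subst hab
      rcases ih with h | ⟨u, c, k, hc, h⟩
      · left
        rw [List.length_append, List.length_singleton, List.replicate_succ', ← h]
      · right
        refine ⟨u, c, k + 1, hc, ?_⟩
        rw [h, List.replicate_succ']
        simp
    · exact Or.inr ⟨w, a, 0, hab, rfl⟩

/-! ### The corners at a vertex -/

open Classical in
/-- The corners of order `m` at the point `X`. -/
def fiber (P : Fin d → Ambient d) (m : ℕ) (X : Ambient d) : Finset (List (Fin d) × Fin d) :=
  (corners d m).filter fun c => cornerPoint P c = X

theorem mem_fiber {P : Fin d → Ambient d} {m : ℕ} {X : Ambient d} {c : List (Fin d) × Fin d} :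
    c ∈ fiber P m X ↔ c.1.length = m ∧ cornerPoint P c = X := by
  simp [fiber, mem_corners]

/-- The midpoint is born at order `|u| + 1` in the cells `ua` and `ub`. At each later order it stays
in the two subcells obtained by repeating the corner letter, and `eq_or_partner_of_weight_eq`
excludes all others. -/
theorem fiber_eq_pair {P : Fin d → Ambient d} (hP : AffineIndependent ℝ P) (u : List (Fin d))
    {a b : Fin d} (hab : a ≠ b) (k : ℕ) :
    fiber P (u.length + 1 + k) (wordMap P u (contraction P a (P b))) =
      {(u ++ a :: List.replicate k b, b), (u ++ b :: List.replicate k a, a)} := by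
  have hX : ∀ a b : Fin d, wordMap P (u ++ a :: List.replicate k b) (P b) =
      wordMap P u (contraction P a (P b)) := by
    intro a b
    rw [wordMap_append, wordMap, Function.comp_apply, wordMap_replicate]
  ext ⟨w, i⟩
  simp only [mem_fiber, Finset.mem_insert, Finset.mem_singleton, Prod.mk.injEq, cornerPoint]
  constructor
  · rintro ⟨hl, h⟩
    rw [← hX] at h
    have hl' : (u ++ a :: List.replicate k b).length = w.length := by
      rw [hl]
      simp
      omega
    rcases eq_or_partner_of_weight_eq hl' (weight_eq_of_cornerPoint_eq hP hl' h.symm) with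
      ⟨rfl, rfl⟩ | ⟨u', k', h1, h2, h3⟩
    · exact Or.inl ⟨rfl, rfl⟩
    · obtain ⟨rfl, rfl, rfl⟩ := append_cons_replicate_inj hab h3 h1
      exact Or.inr ⟨h2, rfl⟩
  · rintro (⟨rfl, rfl⟩ | ⟨rfl, rfl⟩)
    · exact ⟨by simp; omega, hX _ _⟩
    · exact ⟨by simp; omega, by rw [hX, contraction_comm]⟩

/-- This is the source of the factor 2 in the spline integral and in the stability estimate. -/
theorem card_fiber {P : Fin d → Ambient d} (hP : AffineIndependent ℝ P) {m : ℕ} {X : Ambient d}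
    (hX : X ∈ interiorVertices P m) : (fiber P m X).card = 2 := by
  rw [interiorVertices, Finset.mem_sdiff, mem_vertices] at hX
  obtain ⟨⟨⟨w, b⟩, hl, rfl⟩, h0⟩ := hX
  rw [mem_corners] at hl
  rcases eq_replicate_or_exists_append w b with h | ⟨u, a, k, hab, rfl⟩
  · exfalso
    apply h0
    rw [cornerPoint, h, wordMap_replicate]
    simp [vertices]
  · have h1 : cornerPoint P (u ++ a :: List.replicate k b, b) =
        wordMap P u (contraction P a (P b)) := by
      rw [cornerPoint, wordMap_append, wordMap, Function.comp_apply, wordMap_replicate]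
    have h2 : m = u.length + 1 + k := by
      rw [← hl]
      simp
      omega
    rw [h1, h2, fiber_eq_pair hP u hab k, Finset.card_pair]
    simp [hab.symm]

/-! ### Nested vertex sets and edge midpoints -/

theorem vertices_mono_succ (P : Fin d → Ambient d) (m : ℕ) : vertices P m ⊆ vertices P (m + 1) := by
  intro X hX
  obtain ⟨⟨w, i⟩, hl, rfl⟩ := (mem_vertices P).1 hX
  rw [mem_corners] at hl
  refine (mem_vertices P).2 ⟨(w ++ [i], i), by simpa [mem_corners] using hl, ?_⟩
  rw [cornerPoint, wordMap_append, wordMap, wordMap, Function.comp_apply, id, contraction_self,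
    cornerPoint]

theorem vertices_mono (P : Fin d → Ambient d) : Monotone (vertices P) :=
  monotone_nat_of_le_succ (vertices_mono_succ P)

theorem interiorVertices_mono (P : Fin d → Ambient d) : Monotone (interiorVertices P) :=
  fun _ _ h => Finset.sdiff_subset_sdiff (vertices_mono P h) le_rfl

theorem midpoint_mem_vertices (P : Fin d → Ambient d) {m : ℕ} {w : List (Fin d)}
    (hw : w.length = m) (a b : Fin d) :
    wordMap P w (contraction P a (P b)) ∈ vertices P (m + 1) := by
  refine (mem_vertices P).2 ⟨(w ++ [a], b), by simpa [mem_corners] using hw, ?_⟩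
  rw [cornerPoint, wordMap_append, wordMap, wordMap, Function.comp_apply, id]

/-- Parity: at order `m + 1` an old vertex has even coordinates, whereas coordinate `a` of this
midpoint is odd. -/
theorem midpoint_notMem_vertices {P : Fin d → Ambient d} (hP : AffineIndependent ℝ P) {m : ℕ}
    {w : List (Fin d)} (hw : w.length = m) {a b : Fin d} (hab : a ≠ b) :
    wordMap P w (contraction P a (P b)) ∉ vertices P m := by
  intro h
  obtain ⟨⟨w', i⟩, hl, h⟩ := (mem_vertices P).1 h
  rw [mem_corners] at hl
  have h' : wordMap P (w ++ [a]) (P b) = wordMap P (w' ++ [i]) (P i) := by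
    rw [wordMap_append, wordMap_append]
    simp only [wordMap, Function.comp_apply, id, contraction_self]
    exact h.symm
  have h2 := congrFun (weight_eq_of_cornerPoint_eq hP (by simp [hw, hl]) h') a
  rw [weight_concat, weight_concat] at h2
  simp only [Pi.add_apply, Pi.smul_apply, smul_eq_mul, Pi.single_eq_same,
    Pi.single_eq_of_ne hab] at h2
  omega

theorem midpoint_mem_interiorVertices {P : Fin d → Ambient d} (hP : AffineIndependent ℝ P) {m : ℕ}
    {w : List (Fin d)} (hw : w.length = m) {a b : Fin d} (hab : a ≠ b) :
    wordMap P w (contraction P a (P b)) ∈ interiorVertices P (m + 1) :=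
  Finset.mem_sdiff.2 ⟨midpoint_mem_vertices P hw a b, fun h =>
    midpoint_notMem_vertices hP hw hab (vertices_mono P (Nat.zero_le m) h)⟩

/-! ### The graph Laplacian as a sum over cells -/

/-- The Laplacian at a corner of the complete graph on the vertices of its cell. -/
def cellLaplacian (P : Fin d → Ambient d) (v : Ambient d → ℝ) (c : List (Fin d) × Fin d) : ℝ :=
  ∑ j, (v (wordMap P c.1 (P j)) - v (cornerPoint P c))

/-- Two vertices determine their cell, so no neighbour of `X` is counted in two cells. The term at
the corner itself vanishes, which is why `cellLaplacian` can sum over all `j`. -/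
theorem graphLaplacian_eq {P : Fin d → Ambient d} (hP : AffineIndependent ℝ P) (m : ℕ)
    (v : Ambient d → ℝ) (X : Ambient d) :
    graphLaplacian P m v X = ∑ c ∈ fiber P m X, cellLaplacian P v c := by
  classical
  have hinj : ∀ w : List (Fin d), Function.Injective fun j => wordMap P w (P j) :=
    fun w => (wordMap_injective P w).comp hP.injective
  have h1 : ∑ c ∈ fiber P m X, cellLaplacian P v c =
      ∑ p ∈ (fiber P m X ×ˢ Finset.univ).filter fun p => p.2 ≠ p.1.2,
        (v (wordMap P p.1.1 (P p.2)) - v X) := by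
    rw [Finset.sum_filter_of_ne, Finset.sum_product]
    · refine Finset.sum_congr rfl fun c hc => ?_
      rw [cellLaplacian, (mem_fiber.1 hc).2]
    · rintro ⟨⟨w, i⟩, j⟩ hp h1 h2
      have h3 := (mem_fiber.1 (Finset.mem_product.1 hp).1).2
      simp only at h2
      subst h2
      apply h1
      rw [← h3, cornerPoint, sub_self]
  rw [h1, graphLaplacian]
  symm
  refine Finset.sum_bij (fun p _ => wordMap P p.1.1 (P p.2)) ?_ ?_ ?_ ?_
  · rintro ⟨⟨w, i⟩, j⟩ hp
    simp only [Finset.mem_filter, Finset.mem_product, mem_fiber, Finset.mem_univ, and_true] at hp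
    obtain ⟨⟨hl, rfl⟩, hij⟩ := hp
    refine Finset.mem_filter.2 ⟨cornerPoint_mem_vertices P (c := (w, j)) hl, ?_, w, hl, i, j, rfl, rfl⟩
    exact fun h => hij (hinj w h).symm
  · rintro ⟨⟨w, i⟩, j⟩ hp ⟨⟨w', i'⟩, j'⟩ hp' h
    simp only [Finset.mem_filter, Finset.mem_product, mem_fiber, Finset.mem_univ, and_true]
      at hp hp' h
    obtain ⟨⟨hl, hX⟩, hij⟩ := hp
    obtain ⟨⟨hl', hX'⟩, hij'⟩ := hp'
    have hll := hl.trans hl'.symm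
    have hww := eq_of_weight_eq_of_weight_eq hll (Ne.symm hij)
      (weight_eq_of_cornerPoint_eq hP hll (hX.trans hX'.symm))
      (weight_eq_of_cornerPoint_eq hP hll h)
    subst hww
    have h1 : i = i' := hinj w (hX.trans hX'.symm)
    have h2 : j = j' := hinj w h
    rw [h1, h2]
  · intro Y hY
    obtain ⟨-, hne, w, hl, i, j, rfl, rfl⟩ := Finset.mem_filter.1 hY
    refine ⟨((w, i), j), ?_, rfl⟩
    simp only [Finset.mem_filter, Finset.mem_product, mem_fiber, Finset.mem_univ, and_true]
    refine ⟨⟨hl, rfl⟩, ?_⟩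
    rintro rfl
    exact hne rfl
  · intro p _
    rfl

theorem sum_vertices_fiber (P : Fin d → Ambient d) (m : ℕ) (G : List (Fin d) × Fin d → ℝ) :
    ∑ X ∈ vertices P m, ∑ c ∈ fiber P m X, G c = ∑ c ∈ corners d m, G c := by
  classical
  rw [← Finset.sum_fiberwise_of_maps_to (s := corners d m) (t := vertices P m)
    (g := cornerPoint P) fun c hc => cornerPoint_mem_vertices P (mem_corners.1 hc)]
  refine Finset.sum_congr rfl fun X _ => Finset.sum_congr ?_ fun _ _ => rfl
  simp [fiber]

theorem sum_corners (m : ℕ) (G : List (Fin d) × Fin d → ℝ) :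
    ∑ c ∈ corners d m, G c = ∑ w ∈ words d m, ∑ i, G (w, i) := by
  rw [corners, Finset.sum_product]

theorem graphLaplacian_midpoint {P : Fin d → Ambient d} (hP : AffineIndependent ℝ P) {m : ℕ}
    {w : List (Fin d)} (hw : w.length = m) {a b : Fin d} (hab : a ≠ b) (v : Ambient d → ℝ) :
    graphLaplacian P (m + 1) v (wordMap P w (contraction P a (P b))) =
      ∑ c, (v (wordMap P w (contraction P a (P c))) - v (wordMap P w (contraction P a (P b)))) +
      ∑ c, (v (wordMap P w (contraction P b (P c))) -
        v (wordMap P w (contraction P a (P b)))) := by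
  have h := fiber_eq_pair hP w hab 0
  rw [hw, add_zero] at h
  have hne : (w ++ a :: List.replicate 0 b, b) ≠ (w ++ b :: List.replicate 0 a, a) := by
    simp [hab.symm]
  rw [graphLaplacian_eq hP, h, Finset.sum_pair hne]
  simp only [cellLaplacian, cornerPoint, List.replicate_zero, wordMap_append, wordMap,
    Function.comp_apply, id]
  rw [contraction_comm P b a]

/-! ### The integral of a harmonic spline -/

/-- Let `y a b` be the values at the corners (`a = b`) and midpoints of one cell. The Laplacian
expression, summed over all ordered pairs, cancels identically. Its off-diagonal terms vanish by
harmonicity, so the diagonal ones sum to zero, which says `∑ y a b = d ∑ y a a`. -/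
theorem sum_corners_succ_of_harmonic {P : Fin d → Ambient d} (hP : AffineIndependent ℝ P)
    {m n : ℕ} (hmn : m ≤ n) {X : Ambient d} {ψ : Ambient d → ℝ} (hψ : IsHarmonicSpline P m X ψ) :
    ∑ c ∈ corners d (n + 1), ψ (cornerPoint P c) =
      d * ∑ c ∈ corners d n, ψ (cornerPoint P c) := by
  rw [sum_corners, sum_corners, sum_words_succ, Finset.mul_sum]
  refine Finset.sum_congr rfl fun w hw => ?_
  have hl := mem_words.1 hw
  simp only [cornerPoint, wordMap_append, wordMap, Function.comp_apply, id]
  set y : Fin d → Fin d → ℝ := fun a b => ψ (wordMap P w (contraction P a (P b))) with hy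
  have hdiag : ∀ i, ψ (wordMap P w (P i)) = y i i := fun i => by
    simp only [hy, contraction_self]
  have key : ∀ a b, ∑ c, (y a c - y a b) + ∑ c, (y b c - y a b) =
      if a = b then 2 * ∑ c, (y a c - y a a) else 0 := by
    intro a b
    split_ifs with hab
    · subst hab
      ring
    · have h := hψ.harmonic (n + 1) (by omega) _ (midpoint_mem_vertices P hl a b)
        fun h => midpoint_notMem_vertices hP hl hab (vertices_mono P hmn h)
      rwa [graphLaplacian_midpoint hP hl hab] at h
  have hsum : ∑ a, ∑ b, (∑ c, (y a c - y a b) + ∑ c, (y b c - y a b)) =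
      ∑ a, 2 * ∑ c, (y a c - y a a) := by
    refine Finset.sum_congr rfl fun a _ => ?_
    simp only [key]
    simp
  simp only [Finset.sum_sub_distrib, Finset.sum_add_distrib, Finset.sum_const, Finset.card_univ,
    Fintype.card_fin, nsmul_eq_mul, ← Finset.mul_sum] at hsum
  simp only [hdiag]
  change ∑ a, ∑ b, y a b = _
  linarith

theorem sum_corners_of_harmonic {P : Fin d → Ambient d} (hP : AffineIndependent ℝ P)
    {m : ℕ} {X : Ambient d} (hX : X ∈ interiorVertices P m) {ψ : Ambient d → ℝ}
    (hψ : IsHarmonicSpline P m X ψ) (k : ℕ) :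
    ∑ c ∈ corners d (m + k), ψ (cornerPoint P c) = 2 * d ^ k := by
  classical
  induction k with
  | zero =>
    have h : ∀ c ∈ corners d m, ψ (cornerPoint P c) = if cornerPoint P c = X then 1 else 0 := by
      intro c hc
      split_ifs with h
      · rw [h, hψ.eq_one]
      · exact hψ.eq_zero _ (cornerPoint_mem_vertices P (mem_corners.1 hc)) h
    have h2 : ((corners d m).filter fun c => cornerPoint P c = X).card = 2 := by
      rw [← card_fiber hP hX, fiber]
    rw [add_zero, Finset.sum_congr rfl h, Finset.sum_boole, h2]
    simp
  | succ k ih =>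
    rw [← add_assoc, sum_corners_succ_of_harmonic hP (Nat.le_add_right m k) hψ, ih]
    ring

/-! ### The self-similar measure as a limit of averages over corners -/

/-- The set of infinite words with the prefix `w`. -/
def prefixSet (n : ℕ) (w : List (Fin d)) : Set (ℕ → Fin d) :=
  {ω | List.ofFn (fun i : Fin n => ω i) = w}

theorem prefixSet_eq_pi {n : ℕ} (s : Fin n → Fin d) :
    prefixSet n (List.ofFn s) =
      Set.pi (Finset.range n) fun k => if h : k < n then {s ⟨k, h⟩} else Set.univ := by
  ext ω
  simp only [prefixSet, Set.mem_ofPred_eq, List.ofFn_inj, Set.mem_pi, Finset.coe_range,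
    Set.mem_Iio, funext_iff]
  constructor
  · intro h k hk
    simpa [hk] using h ⟨k, hk⟩
  · intro h k
    simpa using h k k.2

theorem measurableSet_prefixSet {n : ℕ} {w : List (Fin d)} (hw : w ∈ words d n) :
    MeasurableSet (prefixSet n w) := by
  obtain ⟨s, -, rfl⟩ := Finset.mem_image.1 hw
  rw [prefixSet_eq_pi]
  refine MeasurableSet.pi (Finset.range n).countable_toSet fun k _ => ?_
  split_ifs <;> simp

theorem measure_prefixSet [NeZero d] {n : ℕ} {w : List (Fin d)} (hw : w ∈ words d n) :
    (Measure.infinitePi fun _ : ℕ => (PMF.uniformOfFintype (Fin d)).toMeasure).real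
      (prefixSet n w) = ((d : ℝ) ^ n)⁻¹ := by
  obtain ⟨s, -, rfl⟩ := Finset.mem_image.1 hw
  rw [prefixSet_eq_pi, Measure.real, Measure.infinitePi_pi]
  · rw [Finset.prod_congr rfl (g := fun _ => ((d : ENNReal))⁻¹)]
    · simp [ENNReal.toReal_inv]
    · intro k hk
      rw [Finset.mem_range] at hk
      rw [dif_pos hk, PMF.toMeasure_apply_singleton _ _ (measurableSet_singleton _)]
      simp
  · intro k _
    split_ifs <;> simp

theorem norm_address_le (P : Fin d → Ambient d) (ω : ℕ → Fin d) :
    ‖address P ω‖ ≤ ∑ i, ‖P i‖ := by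
  have h := (summable_geometric_of_lt_one (r := (2⁻¹ : ℝ)) (by norm_num) (by norm_num)).mul_right
    (2⁻¹ * ∑ i, ‖P i‖)
  refine (tsum_of_norm_bounded h.hasSum fun n => ?_).trans_eq ?_
  · have h1 : ‖P (ω n)‖ ≤ ∑ i, ‖P i‖ :=
      Finset.single_le_sum (f := fun i => ‖P i‖) (fun i _ => norm_nonneg _) (Finset.mem_univ _)
    rw [norm_smul, Real.norm_of_nonneg (by positivity), pow_succ, mul_assoc]
    gcongr
  · rw [tsum_mul_right, tsum_geometric_of_lt_one (by norm_num) (by norm_num)]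
    ring

theorem address_eq_wordMap (P : Fin d → Ambient d) (ω : ℕ → Fin d) (n : ℕ) :
    address P ω = wordMap P (List.ofFn fun i : Fin n => ω i) (address P fun k => ω (n + k)) := by
  induction n generalizing ω with
  | zero => simp [wordMap]
  | succ n ih =>
    rw [address_eq, ih fun k => ω (k + 1), List.ofFn_succ]
    simp only [wordMap, Function.comp_apply, Fin.val_zero, Fin.val_succ]
    congr 3
    funext k
    congr 1
    omega

theorem vertices_subset_simplex (P : Fin d → Ambient d) (m : ℕ) :
    (vertices P m : Set (Ambient d)) ⊆ simplex P := by
  induction m with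
  | zero =>
    intro X hX
    simp only [vertices, Finset.coe_image, Finset.coe_univ, Set.image_univ] at hX
    obtain ⟨i, rfl⟩ := hX
    -- The constant address solves the fixed point equation of `contraction P i`, hence represents
    -- `P i`.
    refine ⟨fun _ => i, ?_⟩
    have h := address_eq P fun _ => i
    rw [contraction, smul_add] at h
    have h2 : address P (fun _ => i) = (2 : ℝ) • ((2⁻¹ : ℝ) • P i) := by
      rw [two_smul]
      nth_rewrite 2 [← sub_eq_of_eq_add' h]
      nth_rewrite 1 [← sub_eq_of_eq_add' h]
      rw [← two_smul ℝ, smul_sub, smul_smul, two_smul]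
      norm_num
    rw [h2, smul_smul]
    norm_num
  | succ m ih =>
    intro X hX
    simp only [vertices, Finset.coe_biUnion, Finset.coe_univ, Set.mem_univ, Set.iUnion_true,
      Finset.coe_image, Set.mem_iUnion] at hX
    obtain ⟨i, Y, hY, rfl⟩ := hX
    rw [simplex_eq_iUnion]
    exact Set.mem_iUnion.2 ⟨i, Y, ih hY, rfl⟩

theorem wordMap_mem_simplex (P : Fin d → Ambient d) (w : List (Fin d)) (i : Fin d) :
    wordMap P w (P i) ∈ simplex P :=
  vertices_subset_simplex P _ (cornerPoint_mem_vertices P (c := (w, i)) rfl)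

theorem tendsto_wordMap_address (P : Fin d → Ambient d) (ω : ℕ → Fin d) (i : Fin d) :
    Tendsto (fun n : ℕ => wordMap P (List.ofFn fun k : Fin n => ω k) (P i)) atTop
      (𝓝 (address P ω)) := by
  rw [tendsto_iff_dist_tendsto_zero]
  have h0 : Tendsto (fun n : ℕ => (2⁻¹ : ℝ) ^ n * (‖P i‖ + ∑ i, ‖P i‖)) atTop (𝓝 0) := by
    have := (tendsto_pow_atTop_nhds_zero_of_lt_one (r := (2⁻¹ : ℝ)) (by norm_num)
      (by norm_num)).mul_const (‖P i‖ + ∑ i, ‖P i‖)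
    rwa [zero_mul] at this
  refine squeeze_zero (fun _ => dist_nonneg) (fun n => ?_) h0
  rw [address_eq_wordMap P ω n, dist_wordMap, List.length_ofFn]
  gcongr
  refine (dist_le_norm_add_norm _ _).trans ?_
  gcongr
  exact norm_address_le P _

/-- The integral over the simplex is the limit of the averages over the corners. -/
theorem tendsto_average_corners [NeZero d] (P : Fin d → Ambient d) {ψ : Ambient d → ℝ}
    (hψ : ContinuousOn ψ (simplex P)) :
    Tendsto (fun n : ℕ => ((d : ℝ) ^ n)⁻¹ * (d : ℝ)⁻¹ * ∑ c ∈ corners d n, ψ (cornerPoint P c))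
      atTop (𝓝 (∫ y, ψ y ∂(selfSimilarMeasure P))) := by
  set ν := Measure.infinitePi fun _ : ℕ => (PMF.uniformOfFintype (Fin d)).toMeasure with hν
  have hK : IsCompact (simplex P) := isCompact_range (continuous_address P)
  have hmeas : Measurable (address P) := (continuous_address P).measurable
  have hint : ∫ y, ψ y ∂(selfSimilarMeasure P) = ∫ ω, ψ (address P ω) ∂ν := by
    rw [selfSimilarMeasure, integral_map hmeas.aemeasurable]
    -- Continuity of `ψ` is known only on the simplex, which carries the whole measure.
    have hres : (ν.map (address P)).restrict (simplex P) = ν.map (address P) := by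
      rw [Measure.restrict_eq_self_of_ae_mem]
      exact (ae_map_iff hmeas.aemeasurable hK.measurableSet).2
        (Eventually.of_forall fun ω => ⟨ω, rfl⟩)
    rw [← hres]
    exact hψ.aestronglyMeasurable hK.measurableSet
  obtain ⟨B, hB⟩ := hK.exists_bound_of_continuousOn hψ
  have hd : (d : ℝ) ≠ 0 := Nat.cast_ne_zero.2 (NeZero.ne d)
  -- Step functions: on the words with prefix `w`, the integrand is replaced by the mean of `ψ` over
  -- the corners of cell `w`.
  let c : List (Fin d) → ℝ := fun w => (d : ℝ)⁻¹ * ∑ i, ψ (wordMap P w (P i))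
  let F : ℕ → (ℕ → Fin d) → ℝ := fun n ω => c (List.ofFn fun i : Fin n => ω i)
  have hF : ∀ n, F n = fun ω => ∑ w ∈ words d n, (prefixSet n w).indicator (fun _ => c w) ω := by
    intro n
    funext ω
    rw [Finset.sum_eq_single (List.ofFn fun i : Fin n => ω i)]
    · rw [Set.indicator_of_mem (by exact rfl)]
    · intro w _ hw
      exact Set.indicator_of_notMem (fun h => hw h.symm) _
    · intro h
      exact absurd (mem_words.2 (by simp)) h
  have hFint : ∀ n, ∫ ω, F n ω ∂ν =
      ((d : ℝ) ^ n)⁻¹ * (d : ℝ)⁻¹ * ∑ c ∈ corners d n, ψ (cornerPoint P c) := by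
    intro n
    rw [hF, integral_finsetSum]
    · rw [sum_corners, Finset.mul_sum]
      refine Finset.sum_congr rfl fun w hw => ?_
      rw [integral_indicator_const _ (measurableSet_prefixSet hw), measure_prefixSet hw,
        smul_eq_mul, mul_assoc]
      rfl
    · intro w hw
      exact (integrable_const _).indicator (measurableSet_prefixSet hw)
  rw [hint]
  simp only [← hFint]
  refine tendsto_integral_of_dominated_convergence (fun _ => B) (fun n => ?_) (integrable_const _)
    (fun n => Eventually.of_forall fun ω => ?_) (Eventually.of_forall fun ω => ?_)
  · rw [hF]
    refine (Finset.measurable_sum _ fun w hw => ?_).aestronglyMeasurable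
    exact measurable_const.indicator (measurableSet_prefixSet hw)
  · simp only [F, c]
    rw [norm_mul, norm_inv, Real.norm_natCast, inv_mul_le_iff₀ (by positivity)]
    refine (norm_sum_le_of_le _ fun i _ => hB _ (wordMap_mem_simplex P _ i)).trans_eq ?_
    simp
  · have h1 : Tendsto (fun n => F n ω) atTop (𝓝 ((d : ℝ)⁻¹ * ∑ _i : Fin d, ψ (address P ω))) := by
      refine (tendsto_finsetSum _ fun i _ => ?_).const_mul _
      refine (hψ (address P ω) ⟨ω, rfl⟩).tendsto.comp (tendsto_nhdsWithin_iff.2 ⟨?_, ?_⟩)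
      · exact tendsto_wordMap_address P ω i
      · exact Eventually.of_forall fun n => wordMap_mem_simplex P _ i
    have h2 : (d : ℝ)⁻¹ * ∑ _i : Fin d, ψ (address P ω) = ψ (address P ω) := by
      simp [hd]
    rwa [h2] at h1

/-- The averages over corners are constant from order `m` on: the corner sum is 2 at order `m` and
grows by the factor `d`. -/
theorem integral_harmonicSpline [NeZero d] {P : Fin d → Ambient d} (hP : AffineIndependent ℝ P)
    {m : ℕ} {X : Ambient d} (hX : X ∈ interiorVertices P m) {ψ : Ambient d → ℝ}
    (hψ : IsHarmonicSpline P m X ψ) :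
    ∫ y, ψ y ∂(selfSimilarMeasure P) = 2 / (d : ℝ) ^ (m + 1) := by
  have hd : (d : ℝ) ≠ 0 := Nat.cast_ne_zero.2 (NeZero.ne d)
  refine tendsto_nhds_unique (tendsto_average_corners P hψ.continuousOn) ?_
  refine tendsto_const_nhds.congr' ?_
  filter_upwards [eventually_ge_atTop m] with n hn
  obtain ⟨k, rfl⟩ := Nat.exists_eq_add_of_le hn
  rw [sum_corners_of_harmonic hP hX hψ]
  field_simp
  ring

/-- `((d+2)/d)^m · d^(m+1)/2 = (d/2)(d+2)^m`; the choice of spline plays no further role. -/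
theorem normalizedLaplacian_eq [NeZero d] {P : Fin d → Ambient d} (hP : AffineIndependent ℝ P)
    {m : ℕ} {X : Ambient d} (hX : X ∈ interiorVertices P m) {ψ : Ambient d → ℝ}
    (hψ : IsHarmonicSpline P m X ψ) (v : Ambient d → ℝ) :
    (energyRatio d ^ m)⁻¹ * (∫ y, ψ y ∂(selfSimilarMeasure P))⁻¹ * graphLaplacian P m v X =
      normalizedLaplacian P m v X := by
  have hd : (d : ℝ) ≠ 0 := Nat.cast_ne_zero.2 (NeZero.ne d)
  have hd2 : (d : ℝ) + 2 ≠ 0 := by positivity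
  rw [integral_harmonicSpline hP hX hψ, normalizedLaplacian, energyRatio, div_pow]
  field_simp
  ring

/-! ### Uniform convergence of the normalized graph Laplacians -/

theorem exists_ne_of_mem_interiorVertices {P : Fin d → Ambient d} {m : ℕ} {X : Ambient d}
    (hX : X ∈ interiorVertices P m) : ∃ a b : Fin d, a ≠ b := by
  rw [interiorVertices, Finset.mem_sdiff, mem_vertices] at hX
  obtain ⟨⟨⟨w, b⟩, -, rfl⟩, h0⟩ := hX
  rcases eq_replicate_or_exists_append w b with h | ⟨u, a, k, hab, rfl⟩
  · refine absurd ?_ h0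
    rw [cornerPoint, h, wordMap_replicate]
    simp [vertices]
  · exact ⟨a, b, hab⟩

theorem interiorVertices_subset_simplex (P : Fin d → Ambient d) {m : ℕ} {X : Ambient d}
    (hX : X ∈ interiorVertices P m) : X ∈ simplex P :=
  vertices_subset_simplex P m (Finset.mem_sdiff.1 hX).1

theorem HasLaplacian.tendsto_normalizedLaplacian [NeZero d] {P : Fin d → Ambient d}
    (hP : AffineIndependent ℝ P) {v f : Ambient d → ℝ} (hv : HasLaplacian P v f) {x : Ambient d}
    (hx : x ∈ simplex P) {X : ℕ → Ambient d} (hX : ∀ m, 1 ≤ m → X m ∈ interiorVertices P m)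
    (hXx : Tendsto X atTop (𝓝 x)) :
    Tendsto (fun m => normalizedLaplacian P m v (X m)) atTop (𝓝 (f x)) := by
  obtain ⟨ψ, hψ, hlim⟩ := hv.tendsto x hx X hX hXx
  refine hlim.congr' ?_
  filter_upwards [eventually_ge_atTop 1] with m hm
  exact normalizedLaplacian_eq hP (hX m hm) (hψ m hm) v

/-- Convergence along every sequence `X_m → x`, with continuous limit on a compact set, is uniform.
A sequence of bad vertices would subconverge; it is completed to a sequence over all orders because
the interior vertex sets are nested. -/
theorem HasLaplacian.eventually_abs_sub_le [NeZero d] {P : Fin d → Ambient d}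
    (hP : AffineIndependent ℝ P) {v f : Ambient d → ℝ} (hv : HasLaplacian P v f) {ε : ℝ}
    (hε : 0 < ε) : ∀ᶠ n in atTop, ∀ X ∈ interiorVertices P n,
      |normalizedLaplacian P n v X - f X| ≤ ε := by
  by_contra hcon
  have hfreq : ∃ᶠ n in atTop, ∃ X ∈ interiorVertices P n,
      ε < |normalizedLaplacian P n v X - f X| := by
    refine (not_eventually.1 hcon).mono fun n hn => ?_
    push Not at hn
    exact hn
  obtain ⟨φ₀, hφ₀, hbad⟩ := extraction_of_frequently_atTop hfreq
  choose Y hY hYbad using hbad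
  have hK : IsCompact (simplex P) := isCompact_range (continuous_address P)
  obtain ⟨x, hx, θ, hθ, hlim⟩ :=
    hK.tendsto_subseq fun n => interiorVertices_subset_simplex P (hY n)
  set φ := φ₀ ∘ θ with hφdef
  have hφ : StrictMono φ := hφ₀.comp hθ
  set Z := Y ∘ θ with hZdef
  have hZ : ∀ k, Z k ∈ interiorVertices P (φ k) := fun k => hY _
  -- An interior vertex of order 1, to fill the sequence before the first bad order.
  obtain ⟨a, b, hab⟩ := exists_ne_of_mem_interiorVertices (hZ 0)
  have hx₀ := midpoint_mem_interiorVertices hP (m := 0) (w := []) rfl hab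
  set x₀ := wordMap P [] (contraction P a (P b)) with hx₀def
  -- The index of the last bad order not exceeding `m`; the sequence `W` below holds the
  -- corresponding bad vertex until the next one.
  let κ : ℕ → ℕ := fun m => Nat.findGreatest (fun k => φ k ≤ m) m
  have hκφ : ∀ k, κ (φ k) = k := by
    intro k
    have h1 : k ≤ κ (φ k) := Nat.le_findGreatest hφ.le_apply le_rfl
    have h2 : φ (κ (φ k)) ≤ φ k :=
      Nat.findGreatest_spec (P := fun j => φ j ≤ φ k) (hφ.le_apply (x := k)) le_rfl
    exact le_antisymm (hφ.le_iff_le.1 h2) h1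
  have hκ : Tendsto κ atTop atTop := by
    refine tendsto_atTop.2 fun b => ?_
    filter_upwards [eventually_ge_atTop (φ b)] with m hm
    exact Nat.le_findGreatest (hφ.le_apply.trans hm) hm
  let W : ℕ → Ambient d := fun m => if φ 0 ≤ m then Z (κ m) else x₀
  have hW : ∀ m, 1 ≤ m → W m ∈ interiorVertices P m := by
    intro m hm
    simp only [W]
    split_ifs with h0
    · have h1 : φ (κ m) ≤ m :=
        Nat.findGreatest_spec (P := fun j => φ j ≤ m) (Nat.zero_le m) h0
      exact interiorVertices_mono P h1 (hZ _)
    · exact interiorVertices_mono P hm hx₀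
  have hWx : Tendsto W atTop (𝓝 x) := by
    refine (hlim.comp hκ).congr' ?_
    filter_upwards [eventually_ge_atTop (φ 0)] with m hm
    simp only [W, if_pos hm]
    rfl
  have h1 := (hv.tendsto_normalizedLaplacian hP hx hW hWx).comp hφ.tendsto_atTop
  have hWφ : ∀ k, W (φ k) = Z k := fun k => by
    simp only [W, if_pos (hφ.monotone (Nat.zero_le k)), hκφ]
  have h2 : Tendsto (fun k => f (Z k)) atTop (𝓝 (f x)) :=
    (hv.continuousOn_laplacian x hx).tendsto.comp (tendsto_nhdsWithin_iff.2
      ⟨hlim, Eventually.of_forall fun k => interiorVertices_subset_simplex P (hZ k)⟩)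
  have h3 := (h1.sub h2).abs
  rw [sub_self, abs_zero] at h3
  obtain ⟨k, hk⟩ := (h3.eventually_lt_const hε).exists
  simp only [Function.comp_apply, hWφ] at hk
  exact absurd hk (not_lt.2 (hYbad (θ k)).le)

/-! ### The averaging property of the normalized graph Laplacians -/

/-- The weights are `d + 2` times the values of the harmonic extension from corner `i`: 1 at the
corner, `2/(d+2)` at the adjacent midpoints, `1/(d+2)` at the others. The factor `1/2` compensates
for ordered pairs. -/
theorem cell_identity {y : Fin d → Fin d → ℝ} (hy : ∀ a b, y a b = y b a) (i : Fin d)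
    {D : Fin d → Fin d → ℝ}
    (hD : ∀ a b, D a b = ∑ c, (y a c - y a b) + ∑ c, (y b c - y a b)) :
    d * ∑ j, (y j j - y i i) = (d + 2) * ∑ c, (y i c - y i i) +
      (2 * ∑ b ∈ Finset.univ.erase i, D i b +
        1 / 2 * ∑ a ∈ Finset.univ.erase i, ∑ b ∈ (Finset.univ.erase i).erase a, D a b) := by
  have h1 : ∀ a ∈ Finset.univ.erase i, ∑ b ∈ (Finset.univ.erase i).erase a, D a b =
      ∑ b, D a b - D a i - D a a := by
    intro a ha
    rw [Finset.sum_erase_eq_sub ha, Finset.sum_erase_eq_sub (Finset.mem_univ i)]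
  rw [Finset.sum_congr rfl h1, Finset.sum_erase_eq_sub (Finset.mem_univ i),
    Finset.sum_erase_eq_sub (Finset.mem_univ i)]
  have h2 : ∑ a, y a i = ∑ a, y i a := Finset.sum_congr rfl fun a _ => hy a i
  simp only [hD, Finset.sum_sub_distrib, Finset.sum_add_distrib, Finset.sum_const,
    Finset.card_univ, Fintype.card_fin, nsmul_eq_mul, ← Finset.mul_sum, h2]
  ring

/-- Refinement maps the two cells at `X` injectively to their subcells at `X`, and at order `m + 1`
there are again only two. -/
theorem sum_fiber_succ {P : Fin d → Ambient d} (hP : AffineIndependent ℝ P) {m : ℕ}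
    {X : Ambient d} (hX : X ∈ interiorVertices P m) (G : List (Fin d) × Fin d → ℝ) :
    ∑ c ∈ fiber P (m + 1) X, G c = ∑ c ∈ fiber P m X, G (c.1 ++ [c.2], c.2) := by
  classical
  have hinj : Function.Injective fun c : List (Fin d) × Fin d => (c.1 ++ [c.2], c.2) := by
    rintro ⟨w, i⟩ ⟨w', i'⟩ h
    simp only [Prod.mk.injEq] at h
    exact Prod.ext (List.append_inj' h.1 rfl).1 h.2
  have himg : (fiber P m X).image (fun c => (c.1 ++ [c.2], c.2)) = fiber P (m + 1) X := by
    apply Finset.eq_of_subset_of_card_le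
    · intro c hc
      obtain ⟨⟨w, i⟩, hw, rfl⟩ := Finset.mem_image.1 hc
      obtain ⟨hl, rfl⟩ := mem_fiber.1 hw
      refine mem_fiber.2 ⟨by simpa using hl, ?_⟩
      simp only [cornerPoint, wordMap_append, wordMap, Function.comp_apply, id, contraction_self]
    · rw [Finset.card_image_of_injective _ hinj, card_fiber hP hX,
        card_fiber hP (interiorVertices_mono P (Nat.le_succ m) hX)]
  rw [← himg, Finset.sum_image fun _ _ _ _ h => hinj h]

/-- `d` times the normalized Laplacian of order `m` is a sum of values of the normalized Laplacian
of order `m + 1` weighted by the harmonic spline. -/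
theorem normalizedLaplacian_average {P : Fin d → Ambient d} (hP : AffineIndependent ℝ P) {m : ℕ}
    {X : Ambient d} (hX : X ∈ interiorVertices P m) (v : Ambient d → ℝ) :
    d * normalizedLaplacian P m v X = normalizedLaplacian P (m + 1) v X +
      ((d : ℝ) + 2)⁻¹ * ∑ c ∈ fiber P m X,
        (2 * ∑ b ∈ Finset.univ.erase c.2,
          normalizedLaplacian P (m + 1) v (wordMap P c.1 (contraction P c.2 (P b))) +
        1 / 2 * ∑ a ∈ Finset.univ.erase c.2, ∑ b ∈ (Finset.univ.erase c.2).erase a,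
          normalizedLaplacian P (m + 1) v (wordMap P c.1 (contraction P a (P b)))) := by
  have hcell : ∀ c ∈ fiber P m X, d * cellLaplacian P v c =
      (d + 2) * cellLaplacian P v (c.1 ++ [c.2], c.2) +
      (2 * ∑ b ∈ Finset.univ.erase c.2,
          graphLaplacian P (m + 1) v (wordMap P c.1 (contraction P c.2 (P b))) +
        1 / 2 * ∑ a ∈ Finset.univ.erase c.2, ∑ b ∈ (Finset.univ.erase c.2).erase a,
          graphLaplacian P (m + 1) v (wordMap P c.1 (contraction P a (P b)))) := by
    rintro ⟨w, i⟩ hc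
    have hl := (mem_fiber.1 hc).1
    have h := cell_identity (y := fun a b => v (wordMap P w (contraction P a (P b))))
      (fun a b => by rw [contraction_comm]) i (fun a b => rfl)
    simp only [contraction_self] at h
    -- The formula for `D` in `cell_identity` is the graph Laplacian only off the diagonal; the
    -- erased sums use nothing else.
    have h1 : ∀ a b, a ≠ b → graphLaplacian P (m + 1) v (wordMap P w (contraction P a (P b))) = _ :=
      fun a b hab => graphLaplacian_midpoint hP hl hab v
    have h2 : ∀ b ∈ Finset.univ.erase i, graphLaplacian P (m + 1) v
        (wordMap P w (contraction P i (P b))) = _ :=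
      fun b hb => h1 i b (Finset.ne_of_mem_erase hb).symm
    have h3 : ∀ a ∈ Finset.univ.erase i, ∑ b ∈ (Finset.univ.erase i).erase a,
        graphLaplacian P (m + 1) v (wordMap P w (contraction P a (P b))) = _ :=
      fun a _ => Finset.sum_congr rfl fun b hb => h1 a b (Finset.ne_of_mem_erase hb).symm
    rw [Finset.sum_congr rfl h2, Finset.sum_congr rfl h3]
    simp only [cellLaplacian, cornerPoint, wordMap_append, wordMap, Function.comp_apply, id,
      contraction_self]
    exact h
  have hsum := Finset.sum_congr rfl hcell
  rw [← Finset.mul_sum, Finset.sum_add_distrib, ← Finset.mul_sum, ← graphLaplacian_eq hP,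
    ← sum_fiber_succ hP hX, ← graphLaplacian_eq hP] at hsum
  have hd : (d : ℝ) + 2 ≠ 0 := by positivity
  simp only [normalizedLaplacian, ← Finset.mul_sum]
  have hpull : ∀ A B : List (Fin d) × Fin d → ℝ, ∀ r : ℝ,
      ∑ c ∈ fiber P m X, (2 * (r * A c) + 1 / 2 * (r * B c)) =
        r * ∑ c ∈ fiber P m X, (2 * A c + 1 / 2 * B c) := by
    intro A B r
    rw [Finset.mul_sum]
    exact Finset.sum_congr rfl fun c _ => by ring
  rw [hpull]
  set S := ∑ c ∈ fiber P m X, (2 * ∑ b ∈ Finset.univ.erase c.2,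
          graphLaplacian P (m + 1) v (wordMap P c.1 (contraction P c.2 (P b))) +
        1 / 2 * ∑ a ∈ Finset.univ.erase c.2, ∑ b ∈ (Finset.univ.erase c.2).erase a,
          graphLaplacian P (m + 1) v (wordMap P c.1 (contraction P a (P b)))) with hS
  rw [mul_left_comm, hsum, pow_succ]
  field_simp

/-! ### From averaging to a convergence rate -/

/-- A bound for the distances in the simplex. -/
def diamBound (P : Fin d → Ambient d) : ℝ := 2 * ∑ i, ‖P i‖

theorem diamBound_nonneg (P : Fin d → Ambient d) : 0 ≤ diamBound P :=
  mul_nonneg (by norm_num) (Finset.sum_nonneg fun _ _ => norm_nonneg _)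

theorem dist_le_diamBound {P : Fin d → Ambient d} {x y : Ambient d} (hx : x ∈ simplex P)
    (hy : y ∈ simplex P) : dist x y ≤ diamBound P := by
  obtain ⟨ω, rfl⟩ := hx
  obtain ⟨ω', rfl⟩ := hy
  rw [diamBound, two_mul]
  exact (dist_le_norm_add_norm _ _).trans (add_le_add (norm_address_le P ω) (norm_address_le P ω'))

/-- The weights in `normalizedLaplacian_average` are nonnegative with total `d`, so after division
by `d` the average is convex and keeps any bound around any centre `κ`. -/
theorem abs_normalizedLaplacian_sub_le [NeZero d] {P : Fin d → Ambient d}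
    (hP : AffineIndependent ℝ P) {m : ℕ} {X : Ambient d} (hX : X ∈ interiorVertices P m)
    (v : Ambient d → ℝ) {κ ρ : ℝ}
    (h : ∀ Y ∈ interiorVertices P (m + 1), dist Y X ≤ (2⁻¹ : ℝ) ^ m * diamBound P →
      |normalizedLaplacian P (m + 1) v Y - κ| ≤ ρ) :
    |normalizedLaplacian P m v X - κ| ≤ ρ := by
  have hd : 0 < (d : ℝ) := Nat.cast_pos.2 (Nat.pos_of_ne_zero (NeZero.ne d))
  have hXs := h X (interiorVertices_mono P (Nat.le_succ m) hX)
    (by rw [dist_self]; exact mul_nonneg (by positivity) (diamBound_nonneg P))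
  have hY : ∀ c ∈ fiber P m X, ∀ a b : Fin d, a ≠ b →
      |normalizedLaplacian P (m + 1) v (wordMap P c.1 (contraction P a (P b))) - κ| ≤ ρ := by
    rintro ⟨w, i⟩ hc a b hab
    obtain ⟨hl, rfl⟩ := mem_fiber.1 hc
    refine h _ (midpoint_mem_interiorVertices hP hl hab) ?_
    rw [cornerPoint, dist_wordMap, hl]
    refine mul_le_mul_of_nonneg_left (dist_le_diamBound ?_ ?_) (by positivity)
    · exact wordMap_mem_simplex P [a] b
    · exact wordMap_mem_simplex P [] i
  have hcard : ∀ (i : Fin d) (r : ℝ), ∑ _b ∈ Finset.univ.erase i, r = (d - 1) * r := by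
    intro i r
    rw [Finset.sum_erase_eq_sub (Finset.mem_univ i)]
    simp
    ring
  have hcard2 : ∀ (i : Fin d) (r : ℝ),
      ∑ a ∈ Finset.univ.erase i, ∑ _b ∈ (Finset.univ.erase i).erase a, r =
        (d - 1) * ((d - 2) * r) := by
    intro i r
    rw [← hcard i]
    refine Finset.sum_congr rfl fun a ha => ?_
    rw [Finset.sum_erase_eq_sub ha, hcard]
    ring
  have hfib : ∀ r : ℝ, ∑ _c ∈ fiber P m X, r = 2 * r := by
    intro r
    rw [Finset.sum_const, card_fiber hP hX]
    simp
  have hupper := normalizedLaplacian_average hP hX v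
  -- The midpoint weights of one cell total `2(d-1) + (d-1)(d-2)/2 = (d-1)(d+2)/2`.
  have hbound : ∀ c ∈ fiber P m X,
      |(2 * ∑ b ∈ Finset.univ.erase c.2,
          normalizedLaplacian P (m + 1) v (wordMap P c.1 (contraction P c.2 (P b))) +
        1 / 2 * ∑ a ∈ Finset.univ.erase c.2, ∑ b ∈ (Finset.univ.erase c.2).erase a,
          normalizedLaplacian P (m + 1) v (wordMap P c.1 (contraction P a (P b)))) -
        (d - 1) * (d + 2) / 2 * κ| ≤ (d - 1) * (d + 2) / 2 * ρ := by
    intro c hc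
    have e1 := Finset.abs_sum_le_sum_abs (fun b =>
      normalizedLaplacian P (m + 1) v (wordMap P c.1 (contraction P c.2 (P b))) - κ)
      (Finset.univ.erase c.2)
    have e2 := Finset.sum_le_sum (s := Finset.univ.erase c.2) (g := fun _ => ρ)
      fun b hb => hY c hc c.2 b (Finset.ne_of_mem_erase hb).symm
    have e3 := Finset.abs_sum_le_sum_abs (fun a => ∑ b ∈ (Finset.univ.erase c.2).erase a,
      (normalizedLaplacian P (m + 1) v (wordMap P c.1 (contraction P a (P b))) - κ))
      (Finset.univ.erase c.2)
    have e4 := Finset.sum_le_sum (s := Finset.univ.erase c.2)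
      (g := fun a => ∑ _b ∈ (Finset.univ.erase c.2).erase a, ρ)
      fun a _ => (Finset.abs_sum_le_sum_abs (fun b =>
        normalizedLaplacian P (m + 1) v (wordMap P c.1 (contraction P a (P b))) - κ)
        ((Finset.univ.erase c.2).erase a)).trans
        (Finset.sum_le_sum fun b hb => hY c hc a b (Finset.ne_of_mem_erase hb).symm)
    rw [hcard] at e2
    rw [hcard2] at e4
    have e5 := e1.trans e2
    have e6 := e3.trans e4
    rw [Finset.sum_sub_distrib, hcard] at e5
    simp only [Finset.sum_sub_distrib] at e6
    rw [hcard2, abs_le] at e6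
    rw [abs_le] at e5 ⊢
    constructor <;> nlinarith [e5.1, e5.2, e6.1, e6.2]
  have hsum := (Finset.abs_sum_le_sum_abs _ _).trans (Finset.sum_le_sum hbound)
  rw [Finset.sum_sub_distrib, hfib, hfib] at hsum
  set S := ∑ c ∈ fiber P m X, (2 * ∑ b ∈ Finset.univ.erase c.2,
          normalizedLaplacian P (m + 1) v (wordMap P c.1 (contraction P c.2 (P b))) +
        1 / 2 * ∑ a ∈ Finset.univ.erase c.2, ∑ b ∈ (Finset.univ.erase c.2).erase a,
          normalizedLaplacian P (m + 1) v (wordMap P c.1 (contraction P a (P b)))) with hS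
  have hfinal : d * (normalizedLaplacian P m v X - κ) =
      (normalizedLaplacian P (m + 1) v X - κ) +
        ((d : ℝ) + 2)⁻¹ * (S - 2 * ((d - 1) * (d + 2) / 2 * κ)) := by
    rw [mul_sub, hupper]
    field_simp
    ring
  have h5 : ((d : ℝ) + 2)⁻¹ * (2 * ((d - 1) * (d + 2) / 2 * ρ)) = (d - 1) * ρ := by
    field_simp
  have h6 : d * |normalizedLaplacian P m v X - κ| ≤ d * ρ := by
    rw [← abs_of_pos hd, ← abs_mul, abs_of_pos hd, hfinal]
    refine (abs_add_le _ _).trans ?_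
    rw [abs_mul, abs_of_pos (by positivity : 0 < ((d : ℝ) + 2)⁻¹)]
    have h7 := mul_le_mul_of_nonneg_left hsum (by positivity : 0 ≤ ((d : ℝ) + 2)⁻¹)
    rw [h5] at h7
    linarith
  exact le_of_mul_le_mul_left h6 hd

theorem HasLaplacian.abs_normalizedLaplacian_sub_le [NeZero d] {P : Fin d → Ambient d}
    (hP : AffineIndependent ℝ P) {v f : Ambient d → ℝ} (hv : HasLaplacian P v f) {α H : ℝ}
    (hα : 0 < α) (hH : 0 ≤ H)
    (hf : ∀ x ∈ simplex P, ∀ y ∈ simplex P, |f x - f y| ≤ H * dist x y ^ α)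
    {m : ℕ} {X : Ambient d} (hX : X ∈ interiorVertices P m) :
    |normalizedLaplacian P m v X - f X| ≤
      H * diamBound P ^ α / (1 - (2⁻¹ : ℝ) ^ α) * ((2⁻¹ : ℝ) ^ α) ^ m := by
  set q := (2⁻¹ : ℝ) ^ α with hq
  have hq0 : 0 < q := Real.rpow_pos_of_pos (by norm_num) _
  have hq1 : q < 1 := Real.rpow_lt_one (by norm_num) (by norm_num) hα
  have hD := diamBound_nonneg P
  set A := H * diamBound P ^ α with hA
  have hA0 : 0 ≤ A := mul_nonneg hH (Real.rpow_nonneg hD _)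
  have hq2 : 0 < 1 - q := by linarith
  refine le_of_forall_pos_le_add fun ε hε => ?_
  obtain ⟨n₀, hn₀⟩ := eventually_atTop.1 (hv.eventually_abs_sub_le hP hε)
  -- Induction on the number `k` of orders left before uniform convergence applies. Moving the
  -- centre from `f Y` to `f X` costs `A q^m` per order, and `A / (1 - q) * q^m` is the sum of these
  -- costs from order `m` on.
  have hstep : ∀ k m : ℕ, n₀ ≤ m + k → ∀ X ∈ interiorVertices P m,
      |normalizedLaplacian P m v X - f X| ≤ A / (1 - q) * q ^ m + ε := by
    intro k
    induction k with
    | zero =>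
      intro m hm X hX
      have h1 := hn₀ m hm X hX
      have h2 : 0 ≤ A / (1 - q) * q ^ m := by positivity
      linarith
    | succ k ih =>
      intro m hm X hX
      refine SierpinskiHeat.abs_normalizedLaplacian_sub_le hP hX v fun Y hY hdist => ?_
      have h1 := ih (m + 1) (by omega) Y hY
      have h2 := hf Y (interiorVertices_subset_simplex P hY) X
        (interiorVertices_subset_simplex P hX)
      have h3 : dist Y X ^ α ≤ q ^ m * diamBound P ^ α := by
        refine (Real.rpow_le_rpow dist_nonneg hdist hα.le).trans_eq ?_
        rw [Real.mul_rpow (by positivity) hD, hq, ← Real.rpow_natCast, ← Real.rpow_natCast,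
          ← Real.rpow_mul (by norm_num), ← Real.rpow_mul (by norm_num), mul_comm (m : ℝ)]
      have h4 : |f Y - f X| ≤ A * q ^ m := by
        refine h2.trans ((mul_le_mul_of_nonneg_left h3 hH).trans_eq ?_)
        rw [hA]
        ring
      have h5 : A / (1 - q) * q ^ m = A / (1 - q) * q ^ (m + 1) + A * q ^ m := by
        field_simp
        ring
      calc |normalizedLaplacian P (m + 1) v Y - f X|
          ≤ |normalizedLaplacian P (m + 1) v Y - f Y| + |f Y - f X| := abs_sub_le _ _ _
        _ ≤ _ := by linarith
  exact hstep n₀ m (by omega) X hX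

/-! ### Consistency -/

theorem continuousOn_normalizedLaplacian (P : Fin d → Ambient d) {u : ℝ → Ambient d → ℝ}
    {s : Set ℝ} (hu : ∀ x ∈ simplex P, ContinuousOn (fun t => u t x) s) {m : ℕ} {X : Ambient d}
    (hX : X ∈ simplex P) : ContinuousOn (fun t => normalizedLaplacian P m (u t) X) s := by
  classical
  refine ContinuousOn.mul continuousOn_const ?_
  refine continuousOn_finsetSum _ fun Y hY => (hu Y ?_).sub (hu X hX)
  exact vertices_subset_simplex P m (Finset.mem_filter.1 hY).1

/-- The boundary condition is assumed only for `t < T`; continuity supplies `t = T`, which the last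
time step needs. -/
theorem IsHeatSolution.eq_zero_of_mem_boundary [NeZero d] {P : Fin d → Ambient d} {T : ℝ}
    (hT : 0 < T) {g : Ambient d → ℝ} {u f : ℝ → Ambient d → ℝ} (hu : IsHeatSolution P T g u f)
    {t : ℝ} (ht : t ∈ Icc 0 T) {X : Ambient d} (hX : X ∈ vertices P 0) : u t X = 0 := by
  rcases ht.2.lt_or_eq with h | rfl
  · exact hu.boundary t ⟨ht.1, h⟩ X hX
  · have h1 := ((hu.continuousOn_time X (vertices_subset_simplex P 0 hX)) t ht).mono
      Ico_subset_Icc_self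
    have := right_nhdsWithin_Ico_neBot hT
    refine tendsto_nhds_unique h1.tendsto (tendsto_const_nhds.congr' ?_)
    filter_upwards [self_mem_nhdsWithin] with s hs
    exact (hu.boundary s hs X hX).symm

theorem IsHeatSolution.abs_consistencyError_le [NeZero d] {P : Fin d → Ambient d}
    (hP : AffineIndependent ℝ P) {T : ℝ} (hT : 0 < T) {g : Ambient d → ℝ}
    {u f : ℝ → Ambient d → ℝ} (hu : IsHeatSolution P T g u f) {α H M : ℝ} (hα : 0 < α)
    (hH : ∀ t ∈ Ioo 0 T, ∀ x ∈ simplex P, ∀ y ∈ simplex P, |f t x - f t y| ≤ H * dist x y ^ α)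
    (hM : ∀ s ∈ Ioo 0 T, ∀ t ∈ Ioo 0 T, ∀ x ∈ simplex P, |f s x - f t x| ≤ M * |s - t|)
    {m N k : ℕ} (hk : k < N) {X : Ambient d} (hX : X ∈ interiorVertices P m) :
    |consistencyError P m (T / N) u k X| ≤ |M| * (T / N) +
      |H| * diamBound P ^ α / (1 - (2⁻¹ : ℝ) ^ α) * ((2⁻¹ : ℝ) ^ α) ^ m := by
  have hN : 0 < (N : ℝ) := Nat.cast_pos.2 (by omega)
  set h := T / N with hh
  have hh0 : 0 < h := div_pos hT hN
  have hNh : N * h = T := by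
    rw [hh]
    field_simp
  have hXK := interiorVertices_subset_simplex P hX
  rw [consistencyError, if_neg (Finset.mem_sdiff.1 hX).2]
  have ht0 : 0 ≤ k * h := by positivity
  have ht01 : k * h < ((k + 1 : ℕ) : ℝ) * h := by
    push_cast
    linarith
  have ht1 : ((k + 1 : ℕ) : ℝ) * h ≤ T := by
    rw [← hNh]
    exact mul_le_mul_of_nonneg_right (by exact_mod_cast hk) hh0.le
  have hcont := hu.continuousOn_time X hXK
  obtain ⟨ξ, hξ, hslope⟩ := exists_hasDerivAt_eq_slope (fun s => u s X) (fun s => f s X) ht01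
    (hcont.mono (Icc_subset_Icc ht0 ht1))
    fun t ht => hu.time_deriv t ⟨ht0.trans_lt ht.1, ht.2.trans_le ht1⟩ X hXK
  have hlen : ((k + 1 : ℕ) : ℝ) * h - k * h = h := by
    push_cast
    ring
  rw [hlen] at hslope
  rw [← hslope]
  -- At `t = k * h` with `k = 0` the equation is not available. The estimate is made for `t`
  -- slightly later and passes to the limit, since the graph Laplacian is a finite sum of functions
  -- continuous in time.
  have hlim : Tendsto (fun t => |f ξ X - normalizedLaplacian P m (u t) X|) (𝓝[>] (k * h))
      (𝓝 |f ξ X - normalizedLaplacian P m (u (k * h)) X|) := by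
    have h1 := continuousOn_normalizedLaplacian P hu.continuousOn_time (m := m) hXK (k * h)
      ⟨ht0, ht01.le.trans ht1⟩
    have h2 : ContinuousWithinAt (fun t => normalizedLaplacian P m (u t) X) (Ioi (k * h)) (k * h) :=
      h1.mono_of_mem_nhdsWithin
        (mem_of_superset (Ioo_mem_nhdsGT (ht01.trans_le ht1)) fun t ht =>
          ⟨ht0.trans ht.1.le, ht.2.le⟩)
    exact (tendsto_const_nhds.sub h2.tendsto).abs
  refine le_of_tendsto hlim ?_
  filter_upwards [Ioo_mem_nhdsGT ht01] with t ht
  have htT : t ∈ Ioo 0 T := ⟨ht0.trans_lt ht.1, ht.2.trans_le ht1⟩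
  have hξT : ξ ∈ Ioo 0 T := ⟨ht0.trans_lt hξ.1, hξ.2.trans_le ht1⟩
  have h1 : |f ξ X - f t X| ≤ |M| * h := by
    refine (hM ξ hξT t htT X hXK).trans ?_
    have : |ξ - t| ≤ h := by
      rw [abs_le]
      constructor <;> linarith [hξ.1, hξ.2, ht.1, ht.2]
    exact mul_le_mul (le_abs_self M) this (abs_nonneg _) (abs_nonneg _)
  have h2 := (hu.laplacian t htT).abs_normalizedLaplacian_sub_le hP hα (abs_nonneg H)
    (fun x hx y hy => (hH t htT x hx y hy).trans
      (mul_le_mul_of_nonneg_right (le_abs_self H) (Real.rpow_nonneg dist_nonneg _))) hX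
  rw [abs_sub_comm] at h2
  exact (abs_sub_le _ (f t X) _).trans (add_le_add h1 h2)

/-! ### Stability -/

/-- With `J` the all-ones matrix, `A = J - d` is symmetric and `J² = dJ` gives `A² = -dA`. -/
theorem sum_sq_cell (x : Fin d → ℝ) :
    ∑ i, (∑ j, (x j - x i)) ^ 2 = -(d * ∑ i, x i * ∑ j, (x j - x i)) := by
  have h1 : ∀ i, ∑ j, (x j - x i) = ∑ j, x j - d * x i := fun i => by simp
  have h2 : ∑ i, ∑ j, (x j - x i) = 0 := by
    simp only [h1, Finset.sum_sub_distrib, ← Finset.mul_sum]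
    simp
  have h3 : ∀ i, (∑ j, (x j - x i)) ^ 2 =
      (∑ j, x j) * ∑ j, (x j - x i) - d * (x i * ∑ j, (x j - x i)) := by
    intro i
    rw [sq]
    nth_rewrite 1 [h1 i]
    ring
  rw [Finset.sum_congr rfl fun i _ => h3 i, Finset.sum_sub_distrib, ← Finset.mul_sum, h2,
    ← Finset.mul_sum]
  ring

/-- At an interior vertex `Δ_m v` is a sum of two cell Laplacians, so Cauchy–Schwarz costs a factor
2; `sum_sq_cell` then applies in each cell. -/
theorem sum_graphLaplacian_sq_le {P : Fin d → Ambient d} (hP : AffineIndependent ℝ P) (m : ℕ)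
    (v : Ambient d → ℝ) :
    ∑ X ∈ interiorVertices P m, graphLaplacian P m v X ^ 2 ≤
      -(2 * d * ∑ X ∈ vertices P m, v X * graphLaplacian P m v X) := by
  have h1 : ∑ X ∈ interiorVertices P m, graphLaplacian P m v X ^ 2 ≤
      2 * ∑ c ∈ corners d m, cellLaplacian P v c ^ 2 := by
    rw [← sum_vertices_fiber P, Finset.mul_sum]
    refine (Finset.sum_le_sum fun X hX => ?_).trans
      (Finset.sum_le_sum_of_subset_of_nonneg (Finset.sdiff_subset (t := vertices P 0))
        fun X _ _ => ?_)
    · rw [graphLaplacian_eq hP]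
      have := sq_sum_le_card_mul_sum_sq (s := fiber P m X) (f := cellLaplacian P v)
      rwa [card_fiber hP hX] at this
    · exact mul_nonneg (by norm_num) (Finset.sum_nonneg fun _ _ => sq_nonneg _)
  have h2 : ∑ X ∈ vertices P m, v X * graphLaplacian P m v X =
      ∑ c ∈ corners d m, v (cornerPoint P c) * cellLaplacian P v c := by
    rw [← sum_vertices_fiber P]
    refine Finset.sum_congr rfl fun X _ => ?_
    rw [graphLaplacian_eq hP, Finset.mul_sum]
    exact Finset.sum_congr rfl fun c hc => by rw [(mem_fiber.1 hc).2]
  have h3 : ∑ c ∈ corners d m, cellLaplacian P v c ^ 2 =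
      -(d * ∑ c ∈ corners d m, v (cornerPoint P c) * cellLaplacian P v c) := by
    rw [sum_corners, sum_corners, Finset.mul_sum, ← Finset.sum_neg_distrib]
    exact Finset.sum_congr rfl fun w _ => sum_sq_cell fun i => v (wordMap P w (P i))
  rw [h3] at h1
  rw [h2]
  linarith

/-- The explicit Euler step does not increase the `ℓ²` norm. -/
theorem sum_sq_euler_le [NeZero d] {P : Fin d → Ambient d} (hP : AffineIndependent ℝ P) {m : ℕ}
    {v : Ambient d → ℝ} (hv : ∀ X ∈ vertices P 0, v X = 0) {τ : ℝ} (hτ0 : 0 ≤ τ)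
    (hτ : τ * d ≤ 1) :
    ∑ X ∈ interiorVertices P m, (v X + τ * graphLaplacian P m v X) ^ 2 ≤
      ∑ X ∈ vertices P m, v X ^ 2 := by
  have hd : 0 < (d : ℝ) := Nat.cast_pos.2 (Nat.pos_of_ne_zero (NeZero.ne d))
  have hsub : interiorVertices P m ⊆ vertices P m := Finset.sdiff_subset
  have hz : ∀ X ∈ vertices P m, X ∉ interiorVertices P m → v X = 0 := by
    intro X h1 h2
    by_contra h
    exact h2 (Finset.mem_sdiff.2 ⟨h1, fun h3 => h (hv X h3)⟩)
  have e1 : ∑ X ∈ interiorVertices P m, v X ^ 2 = ∑ X ∈ vertices P m, v X ^ 2 :=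
    Finset.sum_subset hsub fun X h1 h2 => by rw [hz X h1 h2]; ring
  have e2 : ∑ X ∈ interiorVertices P m, v X * graphLaplacian P m v X =
      ∑ X ∈ vertices P m, v X * graphLaplacian P m v X :=
    Finset.sum_subset hsub fun X h1 h2 => by rw [hz X h1 h2]; ring
  have h1 := sum_graphLaplacian_sq_le hP m v
  set R := ∑ X ∈ interiorVertices P m, graphLaplacian P m v X ^ 2 with hR
  set Q := ∑ X ∈ vertices P m, v X * graphLaplacian P m v X with hQ
  have hR0 : 0 ≤ R := Finset.sum_nonneg fun _ _ => sq_nonneg _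
  have h2 : ∑ X ∈ interiorVertices P m, (v X + τ * graphLaplacian P m v X) ^ 2 =
      ∑ X ∈ vertices P m, v X ^ 2 + 2 * τ * Q + τ ^ 2 * R := by
    rw [← e1, ← e2, hR, Finset.mul_sum, Finset.mul_sum, ← Finset.sum_add_distrib,
      ← Finset.sum_add_distrib]
    exact Finset.sum_congr rfl fun X _ => by ring
  -- `τ d R ≤ R ≤ -2dQ`, so `τ R ≤ -2Q`: the quadratic term is absorbed by the dissipation.
  have h3 : d * (τ * R) ≤ d * (-(2 * Q)) := by
    nlinarith [mul_le_mul_of_nonneg_right hτ hR0]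
  have h4 := mul_le_mul_of_nonneg_left (le_of_mul_le_mul_left h3 hd) hτ0
  rw [h2]
  linarith

theorem sqrt_sum_add_sq_le {ι : Type*} (s : Finset ι) (a b : ι → ℝ) :
    √(∑ i ∈ s, (a i + b i) ^ 2) ≤ √(∑ i ∈ s, a i ^ 2) + √(∑ i ∈ s, b i ^ 2) := by
  have ha : 0 ≤ ∑ i ∈ s, a i ^ 2 := Finset.sum_nonneg fun _ _ => sq_nonneg _
  have hb : 0 ≤ ∑ i ∈ s, b i ^ 2 := Finset.sum_nonneg fun _ _ => sq_nonneg _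
  refine Real.sqrt_le_iff.2 ⟨by positivity, ?_⟩
  have h := Real.sum_mul_le_sqrt_mul_sqrt s a b
  rw [add_sq, Real.sq_sqrt ha, Real.sq_sqrt hb]
  have h2 : ∑ i ∈ s, (a i + b i) ^ 2 =
      ∑ i ∈ s, a i ^ 2 + 2 * ∑ i ∈ s, a i * b i + ∑ i ∈ s, b i ^ 2 := by
    rw [Finset.mul_sum, ← Finset.sum_add_distrib, ← Finset.sum_add_distrib]
    exact Finset.sum_congr rfl fun i _ => by ring
  rw [h2]
  linarith

theorem le_normTwoInfty (P : Fin d → Ambient d) (m : ℕ) {K k : ℕ} (hk : k < K)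
    (w : ℕ → Ambient d → ℝ) :
    √(((d : ℝ) ^ m)⁻¹ * ∑ X ∈ vertices P m, |w k X| ^ 2) ≤ normTwoInfty P m K w :=
  le_ciSup (f := fun k : Fin K => √(((d : ℝ) ^ m)⁻¹ * ∑ X ∈ vertices P m, |w k X| ^ 2))
    (Set.finite_range _).bddAbove ⟨k, hk⟩

theorem normTwoInfty_nonneg (P : Fin d → Ambient d) (m K : ℕ) (w : ℕ → Ambient d → ℝ) :
    0 ≤ normTwoInfty P m K w :=
  Real.iSup_nonneg fun _ => Real.sqrt_nonneg _

theorem normTwoInfty_le (P : Fin d → Ambient d) (m : ℕ) {K : ℕ} {w : ℕ → Ambient d → ℝ} {B : ℝ}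
    (hB : 0 ≤ B) (h : ∀ k < K, √(((d : ℝ) ^ m)⁻¹ * ∑ X ∈ vertices P m, |w k X| ^ 2) ≤ B) :
    normTwoInfty P m K w ≤ B :=
  Real.iSup_le (fun k => h k k.2) hB

theorem normalizedLaplacian_sub (P : Fin d → Ambient d) (m : ℕ) (v w : Ambient d → ℝ)
    (X : Ambient d) : normalizedLaplacian P m (fun Y => v Y - w Y) X =
      normalizedLaplacian P m v X - normalizedLaplacian P m w X := by
  rw [normalizedLaplacian, normalizedLaplacian, normalizedLaplacian, ← mul_sub, graphLaplacian,
    graphLaplacian, graphLaplacian, ← Finset.sum_sub_distrib]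
  congr 1
  exact Finset.sum_congr rfl fun Y _ => by ring

theorem eulerScheme_boundary (P : Fin d → Ambient d) (m : ℕ) (h : ℝ) (g : Ambient d → ℝ) (k : ℕ)
    {X : Ambient d} (hX : X ∈ vertices P 0) : eulerScheme P m h g k X = 0 := by
  cases k <;> exact if_pos hX

theorem eulerScheme_zero (P : Fin d → Ambient d) (m : ℕ) (h : ℝ) (g : Ambient d → ℝ)
    {X : Ambient d} (hX : X ∉ vertices P 0) : eulerScheme P m h g 0 X = g X :=
  if_neg hX

theorem eulerScheme_succ (P : Fin d → Ambient d) (m : ℕ) (h : ℝ) (g : Ambient d → ℝ) (k : ℕ)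
    {X : Ambient d} (hX : X ∉ vertices P 0) : eulerScheme P m h g (k + 1) X =
      eulerScheme P m h g k X + h * normalizedLaplacian P m (eulerScheme P m h g k) X :=
  if_neg hX

theorem schemeError_succ (P : Fin d → Ambient d) (m : ℕ) {h : ℝ} (hh : h ≠ 0)
    (g : Ambient d → ℝ) (u : ℝ → Ambient d → ℝ) (k : ℕ) {X : Ambient d} (hX : X ∉ vertices P 0) :
    schemeError P m h g u (k + 1) X = schemeError P m h g u k X +
      h * normalizedLaplacian P m (schemeError P m h g u k) X +
      h * consistencyError P m h u k X := by
  have h1 : normalizedLaplacian P m (schemeError P m h g u k) X =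
      normalizedLaplacian P m (u (k * h)) X -
        normalizedLaplacian P m (eulerScheme P m h g k) X :=
    normalizedLaplacian_sub P m _ _ X
  rw [h1, consistencyError, if_neg hX, schemeError, schemeError,
    eulerScheme_succ P m h g k hX]
  field_simp
  ring

/-- Each step propagates the error without amplification and adds at most `h` times the consistency
norm; there are `N = T / h` steps. -/
theorem IsHeatSolution.normTwoInfty_schemeError_le [NeZero d] {P : Fin d → Ambient d}
    (hP : AffineIndependent ℝ P) {T : ℝ} (hT : 0 < T) {g : Ambient d → ℝ}
    {u f : ℝ → Ambient d → ℝ} (hu : IsHeatSolution P T g u f) {m N : ℕ} (hN : 1 ≤ N)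
    (hcfl : CFL d m (T / N)) :
    normTwoInfty P m (N + 1) (schemeError P m (T / N) g u) ≤
      T * normTwoInfty P m N (consistencyError P m (T / N) u) := by
  classical
  have hd : 0 < (d : ℝ) := Nat.cast_pos.2 (Nat.pos_of_ne_zero (NeZero.ne d))
  have hN' : 0 < (N : ℝ) := Nat.cast_pos.2 hN
  rw [CFL] at hcfl
  set h := T / N with hh
  have hh0 : 0 < h := div_pos hT hN'
  have hNh : N * h = T := by
    rw [hh]
    field_simp
  set B := normTwoInfty P m N (consistencyError P m h u) with hB
  have hB0 : 0 ≤ B := normTwoInfty_nonneg _ _ _ _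
  set e := schemeError P m h g u with he
  set ε := consistencyError P m h u with hε
  set r := ((d : ℝ) ^ m)⁻¹ with hr
  have hr0 : 0 ≤ r := by positivity
  have hkT : ∀ k ≤ N, (k * h : ℝ) ∈ Icc 0 T := fun k hk => by
    refine ⟨by positivity, ?_⟩
    rw [← hNh]
    exact mul_le_mul_of_nonneg_right (by exact_mod_cast hk) hh0.le
  have hbd : ∀ k ≤ N, ∀ X ∈ vertices P 0, e k X = 0 := fun k hk X hX => by
    rw [he, schemeError, eulerScheme_boundary P m h g k hX,
      hu.eq_zero_of_mem_boundary hT (hkT k hk) hX, sub_zero]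
  have key : ∀ k ≤ N, √(r * ∑ X ∈ vertices P m, |e k X| ^ 2) ≤ k * h * B := by
    intro k
    simp only [sq_abs]
    induction k with
    | zero =>
      intro _
      have h0 : ∀ X ∈ vertices P m, e 0 X ^ 2 = 0 := by
        intro X hX
        by_cases hX0 : X ∈ vertices P 0
        · rw [hbd 0 (Nat.zero_le N) X hX0]
          ring
        · rw [he, schemeError, eulerScheme_zero P m h g hX0, Nat.cast_zero, zero_mul,
            hu.initial X (vertices_subset_simplex P m hX)]
          ring
      rw [Finset.sum_eq_zero h0]
      simp
    | succ k ih =>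
      intro hk
      have hk' : k < N := hk
      have ih' := ih hk'.le
      set τ := h * ((d : ℝ) / 2 * ((d : ℝ) + 2) ^ m) with hτ
      -- This is the CFL condition multiplied by `d² / 2`.
      have hτ1 : τ * d ≤ 1 := by
        have h1 := mul_le_mul_of_nonneg_left hcfl (by positivity : 0 ≤ (d : ℝ) ^ 2 / 2)
        have h2 : (d : ℝ) ^ 2 / 2 * (2 / (d : ℝ) ^ 2) = 1 := by field_simp
        rw [h2] at h1
        refine le_of_eq_of_le ?_ h1
        rw [hτ]
        ring
      let a : Ambient d → ℝ := fun X =>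
        if X ∈ vertices P 0 then 0 else e k X + τ * graphLaplacian P m (e k) X
      have hsplit : ∀ X ∈ vertices P m, e (k + 1) X ^ 2 = (a X + h * ε k X) ^ 2 := by
        intro X _
        by_cases hX0 : X ∈ vertices P 0
        · rw [hbd _ hk X hX0]
          simp only [a, if_pos hX0, hε, consistencyError, mul_zero, add_zero]
        · simp only [a, if_neg hX0]
          rw [he, schemeError_succ P m hh0.ne' g u k hX0, normalizedLaplacian, hτ]
          ring
      have ha : ∑ X ∈ vertices P m, a X ^ 2 ≤ ∑ X ∈ vertices P m, e k X ^ 2 := by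
        refine le_of_eq_of_le ?_ (sum_sq_euler_le hP (hbd k hk'.le) (by positivity) hτ1)
        symm
        refine Finset.sum_subset_zero_on_sdiff (Finset.sdiff_subset) ?_ ?_
        · intro X hX
          have hX0 : X ∈ vertices P 0 := by
            by_contra h0
            exact (Finset.mem_sdiff.1 hX).2
              (Finset.mem_sdiff.2 ⟨(Finset.mem_sdiff.1 hX).1, h0⟩)
          simp only [a, if_pos hX0]
          ring
        · intro X hX
          simp only [a, if_neg (Finset.mem_sdiff.1 hX).2]
      have hεB : √r * √(∑ X ∈ vertices P m, ε k X ^ 2) ≤ B := by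
        rw [← Real.sqrt_mul hr0]
        have := le_normTwoInfty P m hk' ε
        simpa only [sq_abs] using this
      have hhε : √(∑ X ∈ vertices P m, (h * ε k X) ^ 2) =
          h * √(∑ X ∈ vertices P m, ε k X ^ 2) := by
        simp only [mul_pow, ← Finset.mul_sum]
        rw [Real.sqrt_mul (sq_nonneg h), Real.sqrt_sq hh0.le]
      rw [Finset.sum_congr rfl hsplit, Real.sqrt_mul hr0]
      rw [Real.sqrt_mul hr0] at ih'
      have h5 := sqrt_sum_add_sq_le (vertices P m) a fun X => h * ε k X
      rw [hhε] at h5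
      have h6 := h5.trans (add_le_add_left (Real.sqrt_le_sqrt ha) _)
      have h7 := mul_le_mul_of_nonneg_left h6 (Real.sqrt_nonneg r)
      have h8 := mul_le_mul_of_nonneg_left hεB hh0.le
      push_cast
      linarith
  refine normTwoInfty_le P m (mul_nonneg hT.le hB0) fun k hk => ?_
  refine (key k (by omega)).trans ?_
  exact mul_le_mul_of_nonneg_right (hkT k (by omega)).2 hB0

/-! ### Convergence -/

theorem card_vertices_le (P : Fin d → Ambient d) (m : ℕ) : (vertices P m).card ≤ d ^ m * d := by
  classical
  have h : vertices P m ⊆ (corners d m).image (cornerPoint P) := fun X hX =>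
    Finset.mem_image.2 ((mem_vertices P).1 hX)
  refine ((Finset.card_le_card h).trans Finset.card_image_le).trans_eq ?_
  rw [corners, Finset.card_product, card_words, Finset.card_univ, Fintype.card_fin]

/-- The norm divides by `d^m`, while `V_m` can have up to `d^(m+1)` points; hence the factor `√d`.
-/
theorem normTwoInfty_le_of_abs_le [NeZero d] (P : Fin d → Ambient d) (m : ℕ) {K : ℕ}
    {w : ℕ → Ambient d → ℝ} {B : ℝ} (hB : 0 ≤ B)
    (h : ∀ k < K, ∀ X ∈ vertices P m, |w k X| ≤ B) : normTwoInfty P m K w ≤ √d * B := by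
  have hd : 0 < (d : ℝ) := Nat.cast_pos.2 (Nat.pos_of_ne_zero (NeZero.ne d))
  refine normTwoInfty_le P m (mul_nonneg (Real.sqrt_nonneg _) hB) fun k hk => ?_
  rw [← Real.sqrt_sq hB, ← Real.sqrt_mul hd.le]
  refine Real.sqrt_le_sqrt ?_
  have h1 : ∑ X ∈ vertices P m, |w k X| ^ 2 ≤ (vertices P m).card * B ^ 2 := by
    rw [← nsmul_eq_mul]
    exact Finset.sum_le_card_nsmul _ _ _ fun X hX =>
      pow_le_pow_left₀ (abs_nonneg _) (h k hk X hX) 2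
  have h2 : ((vertices P m).card : ℝ) ≤ d ^ m * d := by exact_mod_cast card_vertices_le P m
  rw [inv_mul_le_iff₀ (by positivity), ← mul_assoc]
  exact h1.trans (mul_le_mul_of_nonneg_right h2 (sq_nonneg B))

theorem eventually_cflLimit (d : ℕ) (T : ℝ) :
    ∀ᶠ q in cflLimit d T, 1 ≤ q.2 ∧ CFL d q.1 (T / q.2) :=
  mem_inf_of_right (mem_principal_self _)

theorem tendsto_fst_cflLimit (d : ℕ) (T : ℝ) : Tendsto Prod.fst (cflLimit d T) atTop :=
  tendsto_comap.mono_left inf_le_left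

theorem tendsto_step_cflLimit (d : ℕ) {T : ℝ} (hT : 0 < T) :
    Tendsto (fun q : ℕ × ℕ => T / q.2) (cflLimit d T) (𝓝 0) := by
  have h1 : Tendsto (fun m : ℕ => 2 / (d : ℝ) ^ 2 * (((d : ℝ) + 2)⁻¹) ^ m) atTop (𝓝 0) := by
    have hd2 : (1 : ℝ) < d + 2 := by
      have : (0 : ℝ) ≤ d := Nat.cast_nonneg d
      linarith
    have := (tendsto_pow_atTop_nhds_zero_of_lt_one (r := ((d : ℝ) + 2)⁻¹) (by positivity)
      (inv_lt_one_of_one_lt₀ hd2)).const_mul (2 / (d : ℝ) ^ 2)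
    rwa [mul_zero] at this
  refine squeeze_zero' (Eventually.of_forall fun q => by positivity) ?_
    (h1.comp (tendsto_fst_cflLimit d T))
  filter_upwards [eventually_cflLimit d T] with q hq
  rw [Function.comp_apply, inv_pow, ← div_eq_mul_inv, le_div_iff₀ (by positivity)]
  exact hq.2

end SierpinskiHeat

end

/-! ### The convergence theorem -/

open SierpinskiHeat
theorem mainTheorem1 (d : ℕ) [NeZero d] (P : Fin d → Ambient d) (hP : AffineIndependent ℝ P)
    (T : ℝ) (hT : 0 < T) (g : Ambient d → ℝ) (u f : ℝ → Ambient d → ℝ)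
    (hu : IsHeatSolution P T g u f) :
    -- if the scheme is consistent for `u`, then it is convergent under the CFL condition
    (Tendsto (fun q : ℕ × ℕ => normTwoInfty P q.1 q.2 (consistencyError P q.1 (T / q.2) u))
        (cflLimit d T) (𝓝 0) →
      Tendsto (fun q : ℕ × ℕ => normTwoInfty P q.1 (q.2 + 1) (schemeError P q.1 (T / q.2) g u))
        (cflLimit d T) (𝓝 0)) ∧
    -- if `Δu` is Hölder in space and `∂u/∂t` is Lipschitz in time (both are `f`), then the scheme
    -- is consistent and convergent, with rates
    ∀ α H M : ℝ, 0 < α →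
      (∀ t ∈ Ioo 0 T, ∀ x ∈ simplex P, ∀ y ∈ simplex P, |f t x - f t y| ≤ H * dist x y ^ α) →
      (∀ s ∈ Ioo 0 T, ∀ t ∈ Ioo 0 T, ∀ x ∈ simplex P, |f s x - f t x| ≤ M * |s - t|) →
      (∃ C : ℝ, ∀ m N : ℕ, 1 ≤ N →
        (∀ k < N, ∀ X ∈ interiorVertices P m,
          |consistencyError P m (T / N) u k X| ≤ C * (T / N + (2 : ℝ) ^ (-(m : ℝ) * α))) ∧
        (CFL d m (T / N) →
          normTwoInfty P m (N + 1) (schemeError P m (T / N) g u) ≤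
            C * (T / N + (2 : ℝ) ^ (-(m : ℝ) * α)))) ∧
      Tendsto (fun q : ℕ × ℕ => normTwoInfty P q.1 (q.2 + 1) (schemeError P q.1 (T / q.2) g u))
        (cflLimit d T) (𝓝 0) := by
  have hconv : ∀ᶠ q in cflLimit d T, normTwoInfty P q.1 (q.2 + 1)
      (schemeError P q.1 (T / q.2) g u) ≤
        T * normTwoInfty P q.1 q.2 (consistencyError P q.1 (T / q.2) u) := by
    filter_upwards [eventually_cflLimit d T] with q hq
    exact hu.normTwoInfty_schemeError_le hP hT hq.1 hq.2
  refine ⟨fun h => ?_, fun α H M hα hH hM => ?_⟩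
  · have h1 := h.const_mul T
    rw [mul_zero] at h1
    exact squeeze_zero' (Eventually.of_forall fun q => normTwoInfty_nonneg _ _ _ _) hconv h1
  have hrate : ∃ C : ℝ, ∀ m N : ℕ, 1 ≤ N →
      (∀ k < N, ∀ X ∈ interiorVertices P m,
        |consistencyError P m (T / N) u k X| ≤ C * (T / N + (2 : ℝ) ^ (-(m : ℝ) * α))) ∧
      (CFL d m (T / N) → normTwoInfty P m (N + 1) (schemeError P m (T / N) g u) ≤
        C * (T / N + (2 : ℝ) ^ (-(m : ℝ) * α))) := by
    set A := |H| * diamBound P ^ α / (1 - (2⁻¹ : ℝ) ^ α) with hA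
    have hq1 : (2⁻¹ : ℝ) ^ α < 1 := Real.rpow_lt_one (by norm_num) (by norm_num) hα
    have hA0 : 0 ≤ A := div_nonneg (mul_nonneg (abs_nonneg H)
      (Real.rpow_nonneg (diamBound_nonneg P) _)) (by linarith)
    have hpow : ∀ m : ℕ, ((2⁻¹ : ℝ) ^ α) ^ m = (2 : ℝ) ^ (-(m : ℝ) * α) := fun m => by
      rw [← Real.rpow_natCast, ← Real.rpow_mul (by norm_num), Real.inv_rpow (by norm_num),
        ← Real.rpow_neg (by norm_num)]
      congr 1
      ring
    have hC₀ : 0 ≤ |M| + A := add_nonneg (abs_nonneg M) hA0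
    have hmono : 0 ≤ T * √d * (|M| + A) :=
      mul_nonneg (mul_nonneg hT.le (Real.sqrt_nonneg _)) hC₀
    -- The first summand serves the consistency bound, the second the error bound obtained from
    -- stability; their sum serves both.
    refine ⟨(|M| + A) + T * √d * (|M| + A), fun m N hN => ?_⟩
    have hh0 : 0 ≤ T / N := by positivity
    have hp0 : 0 ≤ (2 : ℝ) ^ (-(m : ℝ) * α) := Real.rpow_nonneg (by norm_num) _
    set ρ := T / N + (2 : ℝ) ^ (-(m : ℝ) * α) with hρ
    have hρ0 : 0 ≤ ρ := add_nonneg hh0 hp0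
    have hcons : ∀ k < N, ∀ X ∈ interiorVertices P m,
        |consistencyError P m (T / N) u k X| ≤ (|M| + A) * ρ := by
      intro k hk X hX
      refine (hu.abs_consistencyError_le hP hT hα hH hM hk hX).trans ?_
      rw [hpow, ← hA, hρ]
      have h1 := mul_nonneg (abs_nonneg M) hp0
      have h2 := mul_nonneg hA0 hh0
      linarith
    have hnn := mul_nonneg hmono hρ0
    have hnn' := mul_nonneg hC₀ hρ0
    refine ⟨fun k hk X hX => (hcons k hk X hX).trans (by linarith), fun hcfl => ?_⟩
    refine (hu.normTwoInfty_schemeError_le hP hT hN hcfl).trans ?_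
    have h1 : normTwoInfty P m N (consistencyError P m (T / N) u) ≤ √d * ((|M| + A) * ρ) := by
      refine normTwoInfty_le_of_abs_le P m hnn' fun k hk X hX => ?_
      by_cases hX0 : X ∈ vertices P 0
      · rw [consistencyError, if_pos hX0, abs_zero]
        exact hnn'
      · exact hcons k hk X (Finset.mem_sdiff.2 ⟨hX, hX0⟩)
    have h2 := mul_le_mul_of_nonneg_left h1 hT.le
    linarith
  refine ⟨hrate, ?_⟩
  obtain ⟨C, hC⟩ := hrate
  have hpow : Tendsto (fun m : ℕ => (2 : ℝ) ^ (-(m : ℝ) * α)) atTop (𝓝 0) := by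
    have h1 : Tendsto (fun m : ℕ => (m : ℝ) * α) atTop atTop :=
      tendsto_natCast_atTop_atTop.atTop_mul_const hα
    have h2 := (tendsto_rpow_atBot_of_base_gt_one 2 (by norm_num)).comp
      (tendsto_neg_atTop_atBot.comp h1)
    refine h2.congr fun m => ?_
    simp
  have hlim := ((tendsto_step_cflLimit d hT).add
    (hpow.comp (tendsto_fst_cflLimit d T))).const_mul C
  rw [add_zero, mul_zero] at hlim
  refine squeeze_zero' (Eventually.of_forall fun q => normTwoInfty_nonneg _ _ _ _) ?_ hlim
  filter_upwards [eventually_cflLimit d T] with q hq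
  exact (hC q.1 q.2 hq.1).2 hq.2
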